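/- Let $\rho$ be a density matrix on $\mathbb{C}^d$, let $\Pi$ be an orthogonal projector on $\mathbb{C}^d$, let $\overline{\Pi} = I - \Pi$, and let $\sigma = \overline{\Pi}\rho\overline{\Pi}$. The *conditioned uniform POVM* applied to $\rho$ first performs the projective measurement $\{\Pi,\overline{\Pi}\}$. On outcome $\Pi$, which has probability $\mathrm{tr}(\Pi\rho)$, it outputs $\bot$. On outcome $\overline{\Pi}$, which has probability $\mathrm{tr}(\overline{\Pi}\rho) = \mathrm{tr}(\sigma)$, the state collapses to $\tau = \sigma/\mathrm{tr}(\sigma)$, the uniform POVM $\{d\,|u\rangle\langle u|\,du\}$ is performed on $\tau$ (where $du$ is the Haar probability measure on unit vectors of $\mathbb{C}^d$), and the observed unit vector $|u\rangle$, which has density $d\,\langle u|\tau|u\rangle$ with respect to $du$, is output. To an outcome one associates the matrix $\widehat{\sigma} = (d+1)|u\rangle\langle u| - I$ if the outcome is $|u\rangle$, and $\widehat{\sigma} = 0$ if it is $\bot$. Let $n$ and $k$ be positive integers with $k \le n/2$. Perform the conditioned uniform POVM separately on each of $n$ copies of $\rho$, so that the outcomes are independent, let $\widehat{\sigma}_1,\dots,\widehat{\sigma}_n$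 be the associated matrices, and define the conditioned $k$-th moment estimator $$Y_k = \frac{1}{n(n-1)\cdots(n-k+1)} \sum_{\text{distinct } i_1,\dots,i_k \in [n]} \mathrm{tr}\left(\widehat{\sigma}_{i_1}\widehat{\sigma}_{i_2}\cdots\widehat{\sigma}_{i_k}\right).$$ Then $Y_k$ is real-valued and square-integrable, it is an unbiased estimator of $\mathrm{tr}(\sigma^k)$, i.e. $\mathbf{E}[Y_k] = \mathrm{tr}(\sigma^k)$, and $$\mathrm{Var}[Y_k] \le \frac{24^k}{d} \sum_{j=0}^{k-1} \left(\frac{kd}{n}\right)^{k-j} \mathrm{tr}(\sigma^{2j}),$$ where $\sigma^0 = I$, so that $\mathrm{tr}(\sigma^0) = d$. -/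

import Mathlib

open MeasureTheory
open scoped ComplexOrder

noncomputable section

namespace CondMoment

/-- Density matrices (mixed states) on `ℂ^d`: positive semidefinite with trace one. -/
structure IsDensityMatrix {d : ℕ} (ρ : Matrix (Fin d) (Fin d) ℂ) : Prop where
  posSemidef : ρ.PosSemidef
  trace_eq_one : ρ.trace = 1

/-- Unit vectors of `ℂ^d` (with its Euclidean norm). -/
abbrev UnitVec (d : ℕ) : Type := Metric.sphere (0 : EuclideanSpace ℂ (Fin d)) 1

/-- The uniform ("Haar") probability measure on the unit vectors of `ℂ^d`: the surface measure
of the unit sphere, divided by its total mass. -/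
def haarUnit (d : ℕ) : Measure (UnitVec d) :=
  ((volume : Measure (EuclideanSpace ℂ (Fin d))).toSphere Set.univ)⁻¹ •
    (volume : Measure (EuclideanSpace ℂ (Fin d))).toSphere

/-- The rank-one projector `|u⟩⟨u|`, with entries `u_i * conj u_j`. -/
def ketbra {d : ℕ} (u : UnitVec d) : Matrix (Fin d) (Fin d) ℂ :=
  Matrix.of fun i j => u.1 i * star (u.1 j)

/-- The quadratic form `⟨u|M|u⟩`. -/
def braket {d : ℕ} (M : Matrix (Fin d) (Fin d) ℂ) (u : UnitVec d) : ℂ :=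
  ∑ i, ∑ j, star (u.1 i) * M i j * u.1 j

/-- Distribution of the outcome when the state `ρ` is measured with the uniform POVM
`{d |u⟩⟨u| du}`: density `d ⟨u|ρ|u⟩` with respect to the Haar measure. -/
def uniformPOVM {d : ℕ} (ρ : Matrix (Fin d) (Fin d) ℂ) : Measure (UnitVec d) :=
  (haarUnit d).withDensity fun u => ENNReal.ofReal (d * (braket ρ u).re)

/-- The subnormalized state `(1 - Q) ρ (1 - Q)`, where `1 - Q` is the complementary projector. -/
def subState {d : ℕ} (Q ρ : Matrix (Fin d) (Fin d) ℂ) : Matrix (Fin d) (Fin d) ℂ :=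
  (1 - Q) * ρ * (1 - Q)

/-- Outcomes of the conditioned uniform POVM: `Sum.inl ()` is the symbol `⊥`, and `Sum.inr u` is
the unit vector `u`. -/
abbrev Outcome (d : ℕ) : Type := Unit ⊕ UnitVec d

/-- Outcome distribution of the conditioned uniform POVM on `ρ`. The projective measurement
`{Q, 1 - Q}` is performed first. Outcome `Q` has probability `tr(Q ρ)` and yields `⊥`. Outcome
`1 - Q` has probability `tr((1 - Q) ρ)`; the state collapses to `σ / tr σ`, where
`σ = (1 - Q) ρ (1 - Q)`, and the uniform POVM is applied to it.
(If `tr σ = 0`, the second outcome has weight zero, so the collapsed state is irrelevant.) -/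
def conditionedPOVM {d : ℕ} (Q ρ : Matrix (Fin d) (Fin d) ℂ) : Measure (Outcome d) :=
  ENNReal.ofReal (Q * ρ).trace.re • Measure.dirac (Sum.inl ()) +
    ENNReal.ofReal ((1 - Q) * ρ).trace.re •
      (uniformPOVM ((subState Q ρ).trace⁻¹ • subState Q ρ)).map Sum.inr

/-- The single-copy estimator: `(d + 1) |u⟩⟨u| - 1` on outcome `u`, and `0` on outcome `⊥`. -/
def singleEstimator {d : ℕ} : Outcome d → Matrix (Fin d) (Fin d) ℂ
  | Sum.inl _ => 0
  | Sum.inr u => ((d : ℂ) + 1) • ketbra u - 1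

/-- The joint distribution of the outcomes when each of `n` copies of `ρ` is separately measured
with the conditioned uniform POVM. -/
def outcomeLaw {d : ℕ} (n : ℕ) (Q ρ : Matrix (Fin d) (Fin d) ℂ) : Measure (Fin n → Outcome d) :=
  Measure.pi fun _ => conditionedPOVM Q ρ

/-- The conditioned `k`-th moment estimator, as a function of the `n` outcomes: the average of
`tr(σ̂_{i₁} σ̂_{i₂} ⋯ σ̂_{i_k})` over all `n (n - 1) ⋯ (n - k + 1)` tuples of distinct indices. -/
def momentEstimator {d n : ℕ} (k : ℕ) (x : Fin n → Outcome d) : ℂ :=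
  (n.descFactorial k : ℂ)⁻¹ *
    ∑ i : Fin k ↪ Fin n, (List.ofFn fun a => singleEstimator (x (i a))).prod.trace

end CondMoment

end

/-!
The estimators of distinct copies are i.i.d., and products of independent random matrices multiply
in expectation, so the moment estimator is an unbiased `U`-statistic. Its variance is an average of
covariances of two words in the copies. Conditionally on the shared copies, every other letter
becomes `σ`, so by AM-GM the covariance of two words sharing `m` letters is at most the
second moment of a word with `m` random letters and `k - m` letters `σ`. Two bounds for a single
copy, on `E |tr (X B)|²` and on `E ‖σ ^ a X B‖²` for the Frobenius norm, strip the random letters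
one by one; each costs a factor `3`, and a factor `tr (σ ^ (2 a))` which Chebyshev's sum inequality
merges with the remaining powers of `σ`.

The single-copy bounds are identities between moments `E ⟨u|A|u⟩⟨u|B|u⟩⟨u|C|u⟩` of a uniform unit
vector. Such a moment is a sum over permutations of trace monomials: integrating monomials in the
coordinates against `exp (-‖x‖²)` gives this sum by Fubini, and homogeneity of the monomials
separates the radial integral from the integral over the sphere.
-/

namespace CondMoment

open Matrix
open scoped Matrix.Norms.Frobenius

section LinearAlgebra

variable {ι : Type*} [Fintype ι]

theorem frobenius_norm_sq (A : Matrix ι ι ℂ) : ‖A‖ ^ 2 = ∑ i, ∑ j, ‖A i j‖ ^ 2 := by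
  rw [frobenius_norm_def, ← Real.sqrt_eq_rpow, Real.sq_sqrt (by positivity)]
  simp only [Real.rpow_two]

theorem trace_conjTranspose_mul_self (A : Matrix ι ι ℂ) :
    (Aᴴ * A).trace = ((‖A‖ ^ 2 : ℝ) : ℂ) := by
  rw [frobenius_norm_sq, Finset.sum_comm]
  simp [trace, mul_apply, Complex.conj_mul']

theorem exists_eq_conjTranspose_mul_self {A : Matrix ι ι ℂ} (hA : A.PosSemidef) :
    ∃ M : Matrix ι ι ℂ, A = Mᴴ * M := by
  classical
  open scoped Matrix.Norms.L2Operator MatrixOrder in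
  exact CStarAlgebra.nonneg_iff_eq_star_mul_self.mp hA.nonneg

theorem trace_mul_eq_norm_sq (M N : Matrix ι ι ℂ) :
    (Mᴴ * M * (Nᴴ * N)).trace = ((‖M * Nᴴ‖ ^ 2 : ℝ) : ℂ) := by
  rw [← trace_conjTranspose_mul_self, conjTranspose_mul, conjTranspose_conjTranspose,
    ← Matrix.mul_assoc, trace_mul_comm]
  simp only [Matrix.mul_assoc]

theorem trace_mul_nonneg {A B : Matrix ι ι ℂ} (hA : A.PosSemidef) (hB : B.PosSemidef) :
    0 ≤ (A * B).trace := by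
  obtain ⟨M, rfl⟩ := exists_eq_conjTranspose_mul_self hA
  obtain ⟨N, rfl⟩ := exists_eq_conjTranspose_mul_self hB
  rw [trace_mul_eq_norm_sq, Complex.zero_le_real]
  positivity

theorem re_trace_mul_le {A B : Matrix ι ι ℂ} (hA : A.PosSemidef) (hB : B.PosSemidef) :
    (A * B).trace.re ≤ A.trace.re * B.trace.re := by
  obtain ⟨M, rfl⟩ := exists_eq_conjTranspose_mul_self hA
  obtain ⟨N, rfl⟩ := exists_eq_conjTranspose_mul_self hB
  rw [trace_mul_eq_norm_sq, trace_conjTranspose_mul_self, trace_conjTranspose_mul_self]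
  simp only [Complex.ofReal_re]
  rw [← mul_pow]
  gcongr
  exact (frobenius_norm_mul M Nᴴ).trans_eq (by rw [frobenius_norm_conjTranspose])

variable [DecidableEq ι]

theorem trace_pow_eq_sum_eigenvalues {σ : Matrix ι ι ℂ} (hσ : σ.IsHermitian) (n : ℕ) :
    (σ ^ n).trace = ∑ i, ((hσ.eigenvalues i ^ n : ℝ) : ℂ) := by
  conv_lhs => rw [hσ.spectral_theorem]
  rw [← map_pow, Unitary.conjStarAlgAut_apply, trace_mul_cycle, Unitary.coe_star_mul_self, one_mul,
    diagonal_pow, trace_diagonal]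
  simp

theorem re_trace_pow_nonneg {σ : Matrix ι ι ℂ} (hσ : σ.PosSemidef) (n : ℕ) :
    0 ≤ (σ ^ n).trace.re :=
  (Complex.nonneg_iff.1 (hσ.pow n).trace_nonneg).1

theorem sum_pow_mul_re_trace_pow_nonneg {σ : Matrix ι ι ℂ} (hσ : σ.PosSemidef) {t : ℝ} (ht : 0 ≤ t)
    (k : ℕ) : 0 ≤ ∑ j ∈ Finset.range k, t ^ (k - j) * (σ ^ (2 * j)).trace.re :=
  Finset.sum_nonneg fun _ _ => mul_nonneg (pow_nonneg ht _) (re_trace_pow_nonneg hσ _)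

theorem re_trace_pow_mul_re_trace_pow_le {σ : Matrix ι ι ℂ} (hσ : σ.PosSemidef) (a b : ℕ) :
    (σ ^ a).trace.re * (σ ^ b).trace.re ≤ Fintype.card ι * (σ ^ (a + b)).trace.re := by
  simp only [trace_pow_eq_sum_eigenvalues hσ.1, Complex.re_sum, Complex.ofReal_re]
  have hmono (n : ℕ) : Monovary (fun i => hσ.1.eigenvalues i ^ n) hσ.1.eigenvalues :=
    fun i j hij => pow_le_pow_left₀ (hσ.eigenvalues_nonneg i) hij.le n
  have hab : Monovary (fun i => hσ.1.eigenvalues i ^ a) fun i => hσ.1.eigenvalues i ^ b :=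
    fun i j hij => hmono a (lt_of_pow_lt_pow_left₀ b (hσ.eigenvalues_nonneg j) hij)
  simpa only [pow_add] using hab.sum_mul_sum_le_card_mul_sum

end LinearAlgebra

section ProductMeasure

variable {κ : Type*} {Ω : κ → Type*} [Fintype κ] [DecidableEq κ] [∀ i, MeasurableSpace (Ω i)]
  (μ : ∀ i, Measure (Ω i)) [∀ i, IsProbabilityMeasure (μ i)]

theorem measurePreserving_update (i : κ) :
    MeasurePreserving (fun z : (∀ i, Ω i) × Ω i => Function.update z.1 i z.2)
      ((Measure.pi μ).prod (μ i)) (Measure.pi μ) := by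
  refine ⟨measurable_update', (Measure.pi_eq fun s hs => ?_).symm⟩
  have hpre : (fun z : (∀ i, Ω i) × Ω i => Function.update z.1 i z.2) ⁻¹' Set.univ.pi s =
      Set.univ.pi (Function.update s i Set.univ) ×ˢ s i := by
    ext ⟨x, ω⟩
    simp only [Set.mem_preimage, Set.mem_univ_pi, Set.mem_prod,
      Function.forall_update_iff x fun j ω => ω ∈ s j,
      Function.forall_update_iff s fun j t => x j ∈ t]
    tauto
  rw [Measure.map_apply measurable_update' (.univ_pi hs), hpre, Measure.prod_prod, Measure.pi_pi]
  simp only [Function.apply_update fun j => μ j, measure_univ,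
    Finset.prod_update_of_mem (Finset.mem_univ i), one_mul]
  exact (Fintype.prod_eq_prod_compl_mul i fun j => μ j (s j)).symm

theorem integral_pi_eq_integral_update {E : Type*} [NormedAddCommGroup E] [NormedSpace ℝ E]
    (i : κ) {f : (∀ i, Ω i) → E} (hf : Integrable f (Measure.pi μ)) :
    ∫ x, f x ∂(Measure.pi μ) =
      ∫ x, ∫ ω, f (Function.update x i ω) ∂(μ i) ∂(Measure.pi μ) := by
  have hmp := measurePreserving_update μ i
  calc ∫ x, f x ∂(Measure.pi μ)
      = ∫ z, f (Function.update z.1 i z.2) ∂((Measure.pi μ).prod (μ i)) := by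
        rw [← integral_map hmp.aemeasurable (hmp.map_eq.symm ▸ hf.1), hmp.map_eq]
    _ = _ := integral_prod _ (hmp.integrable_comp_of_integrable hf)

theorem integral_pi_le_of_integral_update_le (i : κ) {f g : (∀ i, Ω i) → ℝ}
    (hf : Integrable f (Measure.pi μ)) (hf0 : 0 ≤ f) (hg : Integrable g (Measure.pi μ))
    (hfg : ∀ x, ∫ ω, f (Function.update x i ω) ∂(μ i) ≤ g x) :
    ∫ x, f x ∂(Measure.pi μ) ≤ ∫ x, g x ∂(Measure.pi μ) := by
  rw [integral_pi_eq_integral_update μ i hf]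
  exact integral_mono_of_nonneg (.of_forall fun x => integral_nonneg fun ω => hf0 _) hg
    (.of_forall hfg)

end ProductMeasure

section EssBounded

variable {ι Ω : Type*} [MeasurableSpace Ω] {μ : Measure Ω} {X Y : Ω → Matrix ι ι ℂ}

/-- A random matrix with essentially bounded entries. -/
def EssBounded (X : Ω → Matrix ι ι ℂ) (μ : Measure Ω) : Prop :=
  ∀ p q, MemLp (fun ω => X ω p q) ⊤ μ

theorem EssBounded.const [IsFiniteMeasure μ] (A : Matrix ι ι ℂ) : EssBounded (fun _ => A) μ :=
  fun _ _ => memLp_const _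

theorem EssBounded.comp_measurePreserving {Ω' : Type*} [MeasurableSpace Ω'] {ν : Measure Ω'}
    {f : Ω' → Ω} (hX : EssBounded X μ) (hf : MeasurePreserving f ν μ) :
    EssBounded (fun ω => X (f ω)) ν :=
  fun p q => (hX p q).comp_measurePreserving hf

variable [Fintype ι]

theorem EssBounded.mul (hX : EssBounded X μ) (hY : EssBounded Y μ) :
    EssBounded (fun ω => X ω * Y ω) μ := fun p q => by
  simp only [mul_apply]
  exact memLp_finsetSum _ fun r _ => (hY r q).mul (hX p r)

theorem EssBounded.memLp_trace (hX : EssBounded X μ) : MemLp (fun ω => (X ω).trace) ⊤ μ :=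
  memLp_finsetSum _ fun p _ => hX p p

theorem EssBounded.integrable_norm_sq [IsFiniteMeasure μ] (hX : EssBounded X μ) :
    Integrable (fun ω => ‖X ω‖ ^ 2) μ := by
  simp only [frobenius_norm_sq]
  exact integrable_finsetSum _ fun p _ => integrable_finsetSum _ fun q _ =>
    ((hX p q).mono_exponent le_top).integrable_norm_pow two_ne_zero

theorem integral_trace_mul_mul [IsFiniteMeasure μ] (hX : EssBounded X μ) {σ : Matrix ι ι ℂ}
    (hσ : ∀ p q, ∫ ω, X ω p q ∂μ = σ p q) (A B : Matrix ι ι ℂ) :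
    ∫ ω, (A * X ω * B).trace ∂μ = (A * σ * B).trace := by
  have hint (p q) : Integrable (fun ω => X ω p q) μ := (hX p q).integrable le_top
  simp only [trace, diag_apply, mul_apply, Finset.sum_mul]
  rw [integral_finsetSum _ fun p _ => integrable_finsetSum _ fun q _ =>
    integrable_finsetSum _ fun r _ => ((hint r q).const_mul _).mul_const _]
  refine Finset.sum_congr rfl fun p _ => ?_
  rw [integral_finsetSum _ fun q _ => integrable_finsetSum _ fun r _ =>
    ((hint r q).const_mul _).mul_const _]
  refine Finset.sum_congr rfl fun q _ => ?_
  rw [integral_finsetSum _ fun r _ => ((hint r q).const_mul _).mul_const _]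
  simp only [integral_mul_const, integral_const_mul, hσ]

theorem integral_re_trace_mul_re_trace_le [IsFiniteMeasure μ] (hX : EssBounded X μ)
    (hY : EssBounded Y μ) :
    ∫ ω, (X ω).trace.re * (Y ω).trace.re ∂μ ≤
      (∫ ω, ‖(X ω).trace‖ ^ 2 ∂μ + ∫ ω, ‖(Y ω).trace‖ ^ 2 ∂μ) / 2 := by
  have hsq {X : Ω → Matrix ι ι ℂ} (hX : EssBounded X μ) :
      Integrable (fun ω => ‖(X ω).trace‖ ^ 2) μ :=
    (hX.memLp_trace.mono_exponent le_top).integrable_norm_pow two_ne_zero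
  have hmul : Integrable (fun ω => (X ω).trace.re * (Y ω).trace.re) μ :=
    (hY.memLp_trace.re.integrable le_top).mul_of_top_right hX.memLp_trace.re
  rw [← integral_add (hsq hX) (hsq hY), ← integral_div]
  refine integral_mono hmul (((hsq hX).add (hsq hY)).div_const 2) fun ω => ?_
  have hre (z : ℂ) : z.re ^ 2 ≤ ‖z‖ ^ 2 :=
    sq_le_sq.2 (by simpa using Complex.abs_re_le_norm z)
  dsimp only [Pi.add_apply]
  linarith [two_mul_le_add_sq (X ω).trace.re (Y ω).trace.re, hre (X ω).trace, hre (Y ω).trace]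

end EssBounded

section WordProduct

variable {ι κ Ω : Type*} [Fintype ι] [DecidableEq ι] [DecidableEq κ]

/-- The product of the matrices `X (x i)` along the word `l`, in which the letters outside `S` are
replaced by `σ`. If `σ` is the mean of `X` and `l` has no repeated letter, this is the conditional
expectation of the full product given the coordinates in `S`. -/
def wordProd (X : Ω → Matrix ι ι ℂ) (σ : Matrix ι ι ℂ) (S : Finset κ) (l : List κ) (x : κ → Ω) :
    Matrix ι ι ℂ :=
  (l.map fun i => if i ∈ S then X (x i) else σ).prod

variable {X : Ω → Matrix ι ι ℂ} {σ : Matrix ι ι ℂ}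

theorem dependsOn_wordProd (S : Finset κ) (l : List κ) :
    DependsOn (wordProd X σ S l) (S ∩ l.toFinset : Finset κ) := fun x y h => by
  refine congrArg List.prod (List.map_congr_left fun i hi => ?_)
  split_ifs with hiS
  · rw [h i (by simp [hi, hiS])]
  · rfl

theorem dependsOn_re_trace_wordProd (S : Finset κ) (l : List κ) :
    DependsOn (fun x => (wordProd X σ S l x).trace.re) (S ∩ l.toFinset : Finset κ) :=
  fun _ _ h => congrArg (fun A : Matrix ι ι ℂ => A.trace.re)
    (dependsOn_wordProd S l h)

theorem wordProd_congr {S T : Finset κ} {l : List κ} (h : ∀ i ∈ l, i ∈ S ↔ i ∈ T) :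
    wordProd X σ S l = wordProd X σ T l :=
  funext fun _ => congrArg List.prod <| List.map_congr_left fun i hi => by simp only [h i hi]

theorem wordProd_empty (l : List κ) (x : κ → Ω) : wordProd X σ ∅ l x = σ ^ l.length := by
  simp only [wordProd, Finset.notMem_empty, if_false, List.map_const', List.prod_replicate]

theorem wordProd_cons (S : Finset κ) (i : κ) (l : List κ) (x : κ → Ω) :
    wordProd X σ S (i :: l) x = (if i ∈ S then X (x i) else σ) * wordProd X σ S l x :=
  List.prod_cons

theorem wordProd_append (S : Finset κ) (l₁ l₂ : List κ) (x : κ → Ω) :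
    wordProd X σ S (l₁ ++ l₂) x = wordProd X σ S l₁ x * wordProd X σ S l₂ x := by
  simp only [wordProd, List.map_append, List.prod_append]

theorem wordProd_update_of_notMem {S : Finset κ} {l : List κ} {i : κ} (h : i ∉ S ∨ i ∉ l)
    (x : κ → Ω) (ω : Ω) :
    wordProd X σ S l (Function.update x i ω) = wordProd X σ S l x :=
  dependsOn_wordProd S l fun j hj => Function.update_of_ne (by aesop) ω x

theorem trace_wordProd_append_comm (S : Finset κ) (l₁ l₂ : List κ) (x : κ → Ω) :
    (wordProd X σ S (l₁ ++ l₂) x).trace = (wordProd X σ S (l₂ ++ l₁) x).trace := by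
  rw [wordProd_append, wordProd_append, trace_mul_comm]

variable [MeasurableSpace Ω] {μ : Measure Ω} [IsProbabilityMeasure μ]

theorem integral_trace_wordProd_update (hX : EssBounded X μ)
    (hσ : ∀ p q, ∫ ω, X ω p q ∂μ = σ p q) {l : List κ} (hl : l.Nodup) (S : Finset κ) (i : κ)
    (x : κ → Ω) :
    ∫ ω, (wordProd X σ S l (Function.update x i ω)).trace ∂μ =
      (wordProd X σ (S.erase i) l x).trace := by
  by_cases hi : i ∈ S ∧ i ∈ l
  · obtain ⟨l₁, l₂, rfl⟩ := List.append_of_mem hi.2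
    obtain ⟨hi₁, hi₂⟩ : i ∉ l₁ ∧ i ∉ l₂ := by grind
    have herase {l' : List κ} (h : i ∉ l') : wordProd X σ (S.erase i) l' = wordProd X σ S l' :=
      wordProd_congr fun j hj => by grind
    simp only [wordProd_append, wordProd_cons, if_pos hi.1, Function.update_self,
      wordProd_update_of_notMem (.inr hi₁), wordProd_update_of_notMem (.inr hi₂),
      Finset.notMem_erase, if_false, ← Matrix.mul_assoc, herase hi₁, herase hi₂]
    exact integral_trace_mul_mul hX hσ _ _
  · have herase : wordProd X σ (S.erase i) l = wordProd X σ S l :=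
      wordProd_congr fun j hj => by grind
    simp only [wordProd_update_of_notMem (not_and_or.1 hi), herase, integral_const, probReal_univ,
      one_smul]

variable [Fintype κ]

theorem essBounded_wordProd (hX : EssBounded X μ) (S : Finset κ) (l : List κ) :
    EssBounded (wordProd X σ S l) (Measure.pi fun _ => μ) := by
  induction l with
  | nil => exact .const 1
  | cons i l ih =>
    change EssBounded (fun x => (if i ∈ S then X (x i) else σ) * wordProd X σ S l x) _
    refine EssBounded.mul ?_ ih
    split_ifs
    · have heval := measurePreserving_eval (fun _ : κ => μ) i
      exact hX.comp_measurePreserving heval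
    · exact .const σ

theorem integral_re_trace_wordProd_mul_eq_erase (hX : EssBounded X μ)
    (hσ : ∀ p q, ∫ ω, X ω p q ∂μ = σ p q) {l : List κ} (hl : l.Nodup) (S : Finset κ) {i : κ}
    {H : (κ → Ω) → ℝ} (hH : Integrable H (Measure.pi fun _ => μ))
    (hHi : ∀ x ω, H (Function.update x i ω) = H x) :
    ∫ x, (wordProd X σ S l x).trace.re * H x ∂(Measure.pi fun _ => μ) =
      ∫ x, (wordProd X σ (S.erase i) l x).trace.re * H x ∂(Measure.pi fun _ => μ) := by
  have htrace := (essBounded_wordProd (σ := σ) hX S l).memLp_trace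
  have hint : Integrable (fun x => (wordProd X σ S l x).trace.re * H x) (Measure.pi fun _ => μ) :=
    hH.mul_of_top_right htrace.re
  rw [integral_pi_eq_integral_update _ i hint]
  refine integral_congr_ae ?_
  have hupd := (measurePreserving_update (fun _ => μ) i).integrable_comp_of_integrable
    (htrace.integrable le_top)
  filter_upwards [hupd.prod_right_ae] with x hx
  simp only [hHi, integral_mul_const]
  rw [← integral_trace_wordProd_update hX hσ hl S i x]
  exact congrArg (· * H x) (integral_re hx)

theorem integral_re_trace_wordProd_mul (hX : EssBounded X μ)
    (hσ : ∀ p q, ∫ ω, X ω p q ∂μ = σ p q) {l : List κ} (hl : l.Nodup) (S T : Finset κ)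
    {H : (κ → Ω) → ℝ} (hH : Integrable H (Measure.pi fun _ => μ)) (hHT : DependsOn H T) :
    ∫ x, (wordProd X σ S l x).trace.re * H x ∂(Measure.pi fun _ => μ) =
      ∫ x, (wordProd X σ (S ∩ T) l x).trace.re * H x ∂(Measure.pi fun _ => μ) := by
  induction S using Finset.strongInduction with
  | H S ih =>
    by_cases hST : S ⊆ T
    · rw [Finset.inter_eq_left.2 hST]
    · obtain ⟨i, hiS, hiT⟩ := Finset.not_subset.1 hST
      have hHi (x : κ → Ω) (ω : Ω) : H (Function.update x i ω) = H x :=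
        hHT fun j hj => Function.update_of_ne (ne_of_mem_of_not_mem hj hiT) ω x
      rw [integral_re_trace_wordProd_mul_eq_erase hX hσ hl S hH hHi,
        ih _ (Finset.erase_ssubset hiS), Finset.erase_inter,
        Finset.erase_eq_of_notMem fun hi => hiT (Finset.mem_inter.1 hi).2]

end WordProduct

section Estimator

variable {ι κ Ω : Type*} [Fintype ι] [DecidableEq ι] [MeasurableSpace Ω]

/-- `X` is an essentially bounded unbiased estimator of the matrix `σ`, whose second moments are
controlled by the constant `C`. -/
structure IsEstimator (μ : Measure Ω) (C : ℝ) (X : Ω → Matrix ι ι ℂ) (σ : Matrix ι ι ℂ) :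
    Prop where
  essBounded : EssBounded X μ
  mean : ∀ p q, ∫ ω, X ω p q ∂μ = σ p q
  trace_sq_le : ∀ B : Matrix ι ι ℂ, ∫ ω, ‖(X ω * B).trace‖ ^ 2 ∂μ ≤ C * ‖B‖ ^ 2
  norm_sq_le : ∀ (a : ℕ) (B : Matrix ι ι ℂ),
    ∫ ω, ‖σ ^ a * X ω * B‖ ^ 2 ∂μ ≤ C * (σ ^ (2 * a)).trace.re * ‖B‖ ^ 2

theorem norm_pow_sq {σ : Matrix ι ι ℂ} (hσ : σ.IsHermitian) (a : ℕ) :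
    ‖σ ^ a‖ ^ 2 = (σ ^ (2 * a)).trace.re := by
  have h := trace_conjTranspose_mul_self (σ ^ a)
  rw [conjTranspose_pow, hσ.eq, ← pow_add, ← two_mul] at h
  rw [h, Complex.ofReal_re]

variable {μ : Measure Ω} {C : ℝ} {X : Ω → Matrix ι ι ℂ} {σ : Matrix ι ι ℂ}
  [Fintype κ] [DecidableEq κ] [IsProbabilityMeasure μ]

theorem integral_norm_sq_pow_mul_wordProd_le (hX : IsEstimator μ C X σ) (hσ : σ.PosSemidef)
    (hC : 0 ≤ C) (S : Finset κ) {l : List κ} (hl : l.Nodup) (a : ℕ) :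
    ∫ x, ‖σ ^ a * wordProd X σ S l x‖ ^ 2 ∂(Measure.pi fun _ => μ) ≤
      (C * Fintype.card ι) ^ l.countP (· ∈ S) *
        (σ ^ (2 * (a + l.countP (· ∉ S)))).trace.re := by
  induction l generalizing a with
  | nil => simp [wordProd, norm_pow_sq hσ.1]
  | cons i l ih =>
    obtain ⟨hil, hl⟩ := List.nodup_cons.1 hl
    have hbdd (l : List κ) := essBounded_wordProd (σ := σ) hX.essBounded S l
    by_cases hi : i ∈ S
    · set c := l.countP (· ∈ S)
      set m := l.countP (· ∉ S)
      calc ∫ x, ‖σ ^ a * wordProd X σ S (i :: l) x‖ ^ 2 ∂(Measure.pi fun _ => μ)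
          ≤ ∫ x, C * (σ ^ (2 * a)).trace.re * ‖wordProd X σ S l x‖ ^ 2
              ∂(Measure.pi fun _ => μ) := by
            refine integral_pi_le_of_integral_update_le _ i
              ((EssBounded.const (σ ^ a)).mul (hbdd (i :: l))).integrable_norm_sq
              (fun x => by positivity) ((hbdd l).integrable_norm_sq.const_mul _) fun x => ?_
            simp only [wordProd_cons, if_pos hi, Function.update_self,
              wordProd_update_of_notMem (.inr hil), ← Matrix.mul_assoc]
            exact hX.norm_sq_le a _
        _ ≤ C * (σ ^ (2 * a)).trace.re * ((C * Fintype.card ι) ^ c * (σ ^ (2 * m)).trace.re) := by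
            rw [integral_const_mul]
            have hpow := re_trace_pow_nonneg hσ (2 * a)
            gcongr
            simpa using ih hl 0
        _ = C * (C * Fintype.card ι) ^ c * ((σ ^ (2 * a)).trace.re * (σ ^ (2 * m)).trace.re) := by
            ring
        _ ≤ C * (C * Fintype.card ι) ^ c * (Fintype.card ι * (σ ^ (2 * a + 2 * m)).trace.re) := by
            exact mul_le_mul_of_nonneg_left (re_trace_pow_mul_re_trace_pow_le hσ _ _)
              (by positivity)
        _ = _ := by
            rw [List.countP_cons_of_pos (by simpa using hi),
              List.countP_cons_of_neg (by simpa using hi), pow_succ, mul_add]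
            ring
    · simp only [wordProd_cons, if_neg hi, ← Matrix.mul_assoc, ← pow_succ]
      refine (ih hl (a + 1)).trans_eq ?_
      rw [List.countP_cons_of_neg (by simpa using hi), List.countP_cons_of_pos (by simpa using hi),
        add_assoc a, add_comm 1]

theorem integral_norm_sq_trace_wordProd_cons_le (hX : IsEstimator μ C X σ) (hσ : σ.PosSemidef)
    (hC : 0 ≤ C) {S : Finset κ} {i : κ} {l : List κ} (hl : (i :: l).Nodup) (hi : i ∈ S) :
    ∫ x, ‖(wordProd X σ S (i :: l) x).trace‖ ^ 2 ∂(Measure.pi fun _ => μ) ≤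
      C * ((C * Fintype.card ι) ^ l.countP (· ∈ S) *
        (σ ^ (2 * l.countP (· ∉ S))).trace.re) := by
  obtain ⟨hil, hl⟩ := List.nodup_cons.1 hl
  have hbdd (l : List κ) := essBounded_wordProd (σ := σ) hX.essBounded S l
  calc ∫ x, ‖(wordProd X σ S (i :: l) x).trace‖ ^ 2 ∂(Measure.pi fun _ => μ)
      ≤ ∫ x, C * ‖wordProd X σ S l x‖ ^ 2 ∂(Measure.pi fun _ => μ) := by
        refine integral_pi_le_of_integral_update_le _ i
          (((hbdd (i :: l)).memLp_trace.mono_exponent le_top).integrable_norm_pow two_ne_zero)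
          (fun x => by positivity) ((hbdd l).integrable_norm_sq.const_mul _) fun x => ?_
        simp only [wordProd_cons, if_pos hi, Function.update_self,
          wordProd_update_of_notMem (.inr hil)]
        exact hX.trace_sq_le _
    _ ≤ _ := by
        rw [integral_const_mul]
        gcongr
        simpa using integral_norm_sq_pow_mul_wordProd_le hX hσ hC S hl 0

theorem integral_norm_sq_trace_wordProd_le (hX : IsEstimator μ C X σ) (hσ : σ.PosSemidef)
    (hC : 0 ≤ C) {S : Finset κ} {l : List κ} (hl : l.Nodup) (hS : ∃ i ∈ l, i ∈ S) :
    Fintype.card ι * ∫ x, ‖(wordProd X σ S l x).trace‖ ^ 2 ∂(Measure.pi fun _ => μ) ≤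
      (C * Fintype.card ι) ^ l.countP (· ∈ S) * (σ ^ (2 * l.countP (· ∉ S))).trace.re := by
  obtain ⟨i, hil, hi⟩ := hS
  obtain ⟨l₁, l₂, rfl⟩ := List.append_of_mem hil
  have hperm : (l₁ ++ i :: l₂).Perm (i :: (l₂ ++ l₁)) := List.perm_append_comm
  simp only [trace_wordProd_append_comm S l₁, List.cons_append, hperm.countP_eq]
  grw [integral_norm_sq_trace_wordProd_cons_le hX hσ hC (hperm.nodup_iff.1 hl) hi]
  rw [List.countP_cons_of_pos (by simpa using hi), List.countP_cons_of_neg (by simpa using hi),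
    pow_succ]
  exact le_of_eq (by ring)

end Estimator

section Covariance

open ProbabilityTheory

theorem countP_mem_toFinset {κ : Type*} [DecidableEq κ] {l : List κ} (hl : l.Nodup) (S : Finset κ) :
    l.countP (· ∈ S) = (l.toFinset ∩ S).card := by
  rw [List.countP_eq_length_filter, ← List.toFinset_card_of_nodup (hl.filter _),
    List.toFinset_filter, ← Finset.filter_mem_eq_inter]
  simp only [decide_eq_true_eq]

variable {ι κ Ω : Type*} [Fintype ι] [DecidableEq ι] [Fintype κ] [DecidableEq κ]
  [MeasurableSpace Ω] {μ : Measure Ω} [IsProbabilityMeasure μ] {C : ℝ} {X : Ω → Matrix ι ι ℂ}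
  {σ : Matrix ι ι ℂ}

theorem memLp_re_trace_wordProd (hX : EssBounded X μ) (S : Finset κ) (l : List κ) :
    MemLp (fun x => (wordProd X σ S l x).trace.re) ⊤ (Measure.pi fun _ => μ) :=
  (essBounded_wordProd hX S l).memLp_trace.re

theorem integral_re_trace_wordProd_univ (hX : IsEstimator μ C X σ) {l : List κ} (hl : l.Nodup) :
    ∫ x, (wordProd X σ Finset.univ l x).trace.re ∂(Measure.pi fun _ => μ) =
      (σ ^ l.length).trace.re := by
  have h := integral_re_trace_wordProd_mul (H := fun _ => 1) hX.essBounded hX.mean hl Finset.univ ∅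
    (integrable_const _) ((dependsOn_const 1).mono (by simp))
  simpa [wordProd_empty] using h

theorem integral_re_trace_wordProd_mul_re_trace_wordProd (hX : IsEstimator μ C X σ)
    {l₁ l₂ : List κ} (hl₁ : l₁.Nodup) (hl₂ : l₂.Nodup) :
    ∫ x, (wordProd X σ Finset.univ l₁ x).trace.re * (wordProd X σ Finset.univ l₂ x).trace.re
        ∂(Measure.pi fun _ => μ) =
      ∫ x, (wordProd X σ l₂.toFinset l₁ x).trace.re * (wordProd X σ l₁.toFinset l₂ x).trace.re
        ∂(Measure.pi fun _ => μ) := by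
  have hint (S : Finset κ) (l : List κ) :=
    (memLp_re_trace_wordProd (σ := σ) hX.essBounded S l).integrable le_top
  have hdep (S : Finset κ) (l : List κ) := dependsOn_re_trace_wordProd (X := X) (σ := σ) S l
  rw [integral_re_trace_wordProd_mul hX.essBounded hX.mean hl₁ _ l₂.toFinset (hint _ _)
    ((hdep _ _).mono (by simp)), Finset.univ_inter]
  simp_rw [mul_comm (wordProd X σ l₂.toFinset l₁ _).trace.re]
  rw [integral_re_trace_wordProd_mul hX.essBounded hX.mean hl₂ _ l₁.toFinset (hint _ _)
    ((hdep _ _).mono (by simp)), Finset.univ_inter]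

theorem covariance_re_trace_wordProd (hX : IsEstimator μ C X σ) {l₁ l₂ : List κ}
    (hl₁ : l₁.Nodup) (hl₂ : l₂.Nodup) :
    cov[fun x => (wordProd X σ Finset.univ l₁ x).trace.re,
        fun x => (wordProd X σ Finset.univ l₂ x).trace.re; Measure.pi fun _ => μ] =
      ∫ x, (wordProd X σ l₂.toFinset l₁ x).trace.re * (wordProd X σ l₁.toFinset l₂ x).trace.re
        ∂(Measure.pi fun _ => μ) - (σ ^ l₁.length).trace.re * (σ ^ l₂.length).trace.re := by
  rw [covariance_eq_sub ((memLp_re_trace_wordProd hX.essBounded _ _).mono_exponent le_top)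
    ((memLp_re_trace_wordProd hX.essBounded _ _).mono_exponent le_top),
    integral_re_trace_wordProd_univ hX hl₁, integral_re_trace_wordProd_univ hX hl₂]
  exact congrArg (· - _) (integral_re_trace_wordProd_mul_re_trace_wordProd hX hl₁ hl₂)

theorem covariance_re_trace_wordProd_of_disjoint (hX : IsEstimator μ C X σ) {l₁ l₂ : List κ}
    (hl₁ : l₁.Nodup) (hl₂ : l₂.Nodup) (hdisj : l₁.Disjoint l₂) :
    cov[fun x => (wordProd X σ Finset.univ l₁ x).trace.re,
        fun x => (wordProd X σ Finset.univ l₂ x).trace.re; Measure.pi fun _ => μ] = 0 := by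
  have h₁ : wordProd X σ l₂.toFinset l₁ = wordProd X σ ∅ l₁ :=
    wordProd_congr fun i hi => by simpa using hdisj hi
  have h₂ : wordProd X σ l₁.toFinset l₂ = wordProd X σ ∅ l₂ :=
    wordProd_congr fun i hi => by simpa using hdisj.symm hi
  simp [covariance_re_trace_wordProd hX hl₁ hl₂, h₁, h₂, wordProd_empty]

theorem covariance_re_trace_wordProd_le (hX : IsEstimator μ C X σ) (hσ : σ.PosSemidef)
    (hC : 0 ≤ C) {l₁ l₂ : List κ} (hl₁ : l₁.Nodup) (hl₂ : l₂.Nodup)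
    (hlength : l₁.length = l₂.length) (hdisj : ¬ l₁.Disjoint l₂) :
    Fintype.card ι * cov[fun x => (wordProd X σ Finset.univ l₁ x).trace.re,
        fun x => (wordProd X σ Finset.univ l₂ x).trace.re; Measure.pi fun _ => μ] ≤
      (C * Fintype.card ι) ^ (l₁.toFinset ∩ l₂.toFinset).card *
        (σ ^ (2 * (l₁.length - (l₁.toFinset ∩ l₂.toFinset).card))).trace.re := by
  obtain ⟨i, hi₁, hi₂⟩ : ∃ i, i ∈ l₁ ∧ i ∈ l₂ := by simpa [List.Disjoint] using hdisj
  have hsq {l l' : List κ} (hl : l.Nodup) (hi : i ∈ l) (hi' : i ∈ l') :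
      Fintype.card ι * ∫ x, ‖(wordProd X σ l'.toFinset l x).trace‖ ^ 2 ∂(Measure.pi fun _ => μ) ≤
        (C * Fintype.card ι) ^ (l.toFinset ∩ l'.toFinset).card *
          (σ ^ (2 * (l.length - (l.toFinset ∩ l'.toFinset).card))).trace.re := by
    have hcount : l.countP (· ∉ l'.toFinset) = l.length - l.countP (· ∈ l'.toFinset) := by
      rw [List.length_eq_countP_add_countP (· ∈ l'.toFinset), Nat.add_sub_cancel_left]
      simp only [decide_not, decide_eq_true_eq]
    rw [← countP_mem_toFinset hl, ← hcount]
    exact integral_norm_sq_trace_wordProd_le hX hσ hC hl ⟨i, hi, by simpa using hi'⟩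
  have h₁ := hsq hl₁ hi₁ hi₂
  have h₂ := hsq hl₂ hi₂ hi₁
  rw [Finset.inter_comm l₂.toFinset, ← hlength] at h₂
  have hmul := integral_re_trace_mul_re_trace_le
    (essBounded_wordProd (σ := σ) hX.essBounded l₂.toFinset l₁)
    (essBounded_wordProd (σ := σ) hX.essBounded l₁.toFinset l₂)
  rw [covariance_re_trace_wordProd hX hl₁ hl₂, ← hlength]
  have hcard : (0 : ℝ) ≤ Fintype.card ι := Nat.cast_nonneg _
  nlinarith [mul_le_mul_of_nonneg_left hmul hcard,
    mul_nonneg hcard (mul_self_nonneg (σ ^ l₁.length).trace.re)]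

end Covariance

section Counting

theorem descFactorial_mul_pow_le {r n : ℕ} (h : r ≤ n) (m : ℕ) :
    r.descFactorial m * n ^ m ≤ n.descFactorial m * r ^ m := by
  induction m with
  | zero => simp
  | succ m ih =>
    have hfactor : (r - m) * n ≤ (n - m) * r := by
      rw [Nat.sub_mul, Nat.sub_mul, mul_comm n r]
      exact Nat.sub_le_sub_left (Nat.mul_le_mul_left m h) _
    rw [Nat.descFactorial_succ, Nat.descFactorial_succ, pow_succ', pow_succ',
      mul_mul_mul_comm, mul_mul_mul_comm (n - m)]
    exact Nat.mul_le_mul hfactor ih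

variable {α β : Type*} [Fintype α] [Fintype β] [DecidableEq α] [DecidableEq β]

theorem card_embedding_mapsTo (A : Finset α) (R : Finset β) :
    Fintype.card {j : α ↪ β // ∀ a ∈ A, j a ∈ R} =
      (Fintype.card β - A.card).descFactorial (Fintype.card α - A.card) *
        R.card.descFactorial A.card := by
  have e : {j : α ↪ β // ∀ a ∈ A, j a ∈ R} ≃
      Σ f : {f : {a // a ∈ A} ↪ β // ∀ a, f a ∈ (R : Set β)},
        {a // a ∉ A} ↪ ↥(Set.range f.1)ᶜ :=
    ((((Equiv.sumCompl (· ∈ A)).symm.embeddingCongr (Equiv.refl β)).trans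
      Equiv.sumEmbeddingEquivSigmaEmbeddingRestricted).subtypeEquiv fun _ => by
        rw [Subtype.forall]; rfl).trans
      (Equiv.subtypeSigmaEquiv _ fun f : {a // a ∈ A} ↪ β => ∀ a, f a ∈ (R : Set β))
  rw [Fintype.card_congr e, Fintype.card_sigma]
  have hfiber (f : {a // a ∈ A} ↪ β) : Fintype.card ({a // a ∉ A} ↪ ↥(Set.range f)ᶜ) =
      (Fintype.card β - A.card).descFactorial (Fintype.card α - A.card) := by
    rw [Fintype.card_embedding_eq, Fintype.card_subtype_compl, Fintype.card_compl_set,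
      Set.card_range_of_injective f.injective, Fintype.card_coe]
  simp only [hfiber, Finset.sum_const, smul_eq_mul, Finset.card_univ]
  rw [Fintype.card_congr (Equiv.codRestrict {a // a ∈ A} (R : Set β)), Fintype.card_embedding_eq,
    mul_comm, Fintype.card_coe]
  exact congrArg (_ * Nat.descFactorial · _) (Fintype.card_coe R)

theorem card_embedding_mapsTo_mul_le (A : Finset α) (R : Finset β) :
    Fintype.card {j : α ↪ β // ∀ a ∈ A, j a ∈ R} * Fintype.card β ^ A.card ≤
      (Fintype.card β).descFactorial (Fintype.card α) * R.card ^ A.card := by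
  calc _ = (Fintype.card β - A.card).descFactorial (Fintype.card α - A.card) *
          (R.card.descFactorial A.card * Fintype.card β ^ A.card) := by
        rw [← mul_assoc, ← card_embedding_mapsTo]
    _ ≤ (Fintype.card β - A.card).descFactorial (Fintype.card α - A.card) *
          ((Fintype.card β).descFactorial A.card * R.card ^ A.card) :=
        Nat.mul_le_mul_left _ (descFactorial_mul_pow_le (Finset.card_le_univ R) _)
    _ = _ := by rw [← mul_assoc, Nat.descFactorial_mul_descFactorial (Finset.card_le_univ A)]

theorem card_embedding_mapsTo_le (A : Finset α) (R : Finset β) :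
    (Fintype.card {j : α ↪ β // ∀ a ∈ A, j a ∈ R} : ℝ) ≤
      (Fintype.card β).descFactorial (Fintype.card α) *
        ((R.card : ℝ) / Fintype.card β) ^ A.card := by
  obtain hβ | hβ := isEmpty_or_nonempty β
  · obtain rfl | ⟨a, -⟩ := A.eq_empty_or_nonempty
    · simp
    · have : IsEmpty {j : α ↪ β // ∀ a ∈ A, j a ∈ R} := ⟨fun j => hβ.elim (j.1 a)⟩
      rw [Fintype.card_eq_zero, Nat.cast_zero]
      positivity
  · rw [div_pow, ← mul_div_assoc, le_div_iff₀ (by positivity)]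
    exact_mod_cast card_embedding_mapsTo_mul_le A R

omit [DecidableEq α] in
theorem sum_card_filter_mem_le (R : Finset β) {g : ℕ → ℝ} (hg : ∀ m, 0 ≤ g m) :
    ∑ j : α ↪ β, g (Finset.univ.filter fun a => j a ∈ R).card ≤
      (Fintype.card β).descFactorial (Fintype.card α) *
        ∑ m ∈ Finset.range (Fintype.card α + 1), (Fintype.card α).choose m *
          (g m * ((R.card : ℝ) / Fintype.card β) ^ m) := by
  classical
  calc ∑ j : α ↪ β, g (Finset.univ.filter fun a => j a ∈ R).card
      ≤ ∑ j : α ↪ β, ∑ A : Finset α, if ∀ a ∈ A, j a ∈ R then g A.card else 0 := by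
        refine Finset.sum_le_sum fun j _ => ?_
        refine (if_pos ?_).symm.trans_le
          (Finset.single_le_sum (f := fun A => if ∀ a ∈ A, j a ∈ R then g A.card else 0)
            (fun A _ => ?_) (Finset.mem_univ (Finset.univ.filter fun a => j a ∈ R)))
        · simp
        · split_ifs
          exacts [hg _, le_rfl]
    _ = ∑ A : Finset α, Fintype.card {j : α ↪ β // ∀ a ∈ A, j a ∈ R} * g A.card := by
        rw [Finset.sum_comm]
        simp only [← Finset.sum_filter, Finset.sum_const, nsmul_eq_mul, Fintype.card_subtype]
    _ ≤ ∑ A : Finset α, (Fintype.card β).descFactorial (Fintype.card α) *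
          (g A.card * ((R.card : ℝ) / Fintype.card β) ^ A.card) := by
        refine Finset.sum_le_sum fun A _ => ?_
        grw [card_embedding_mapsTo_le A R]
        · exact le_of_eq (by ring)
        · exact hg _
    _ = _ := by
        rw [← Finset.mul_sum, ← Finset.powerset_univ,
          Finset.sum_powerset_apply_card (fun m => g m * ((R.card : ℝ) / Fintype.card β) ^ m),
          Finset.card_univ]
        simp only [nsmul_eq_mul]

end Counting

section UStatistic

open ProbabilityTheory

theorem card_toFinset_ofFn_inter {κ : Type*} [DecidableEq κ] {k : ℕ} (i j : Fin k ↪ κ) :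
    ((List.ofFn i).toFinset ∩ (List.ofFn j).toFinset).card =
      (Finset.univ.filter fun a => j a ∈ Finset.univ.map i).card := by
  rw [← Finset.card_map j]
  congr 1
  ext b
  simp only [Finset.mem_inter, List.mem_toFinset, List.mem_ofFn', Finset.mem_map,
    Finset.mem_filter, Finset.mem_univ, true_and, Set.mem_range]
  grind

variable {ι κ Ω : Type*} [Fintype ι] [DecidableEq ι] [Fintype κ] {k : ℕ}

/-- The `U`-statistic with kernel `tr (X₁ ⋯ X_k)`: the average of the kernel over all `k`-tuples of
distinct coordinates. -/
noncomputable def uStatistic (X : Ω → Matrix ι ι ℂ) (k : ℕ) (x : κ → Ω) : ℂ :=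
  ((Fintype.card κ).descFactorial k : ℂ)⁻¹ *
    ∑ i : Fin k ↪ κ, (List.ofFn fun a => X (x (i a))).prod.trace

/-- The bound on `card ι` times the covariance of the kernels of two `k`-tuples that share `m`
indices. -/
noncomputable def overlapBound (C : ℝ) (σ : Matrix ι ι ℂ) (k m : ℕ) : ℝ :=
  if m = 0 then 0 else (C * Fintype.card ι) ^ m * (σ ^ (2 * (k - m))).trace.re

theorem overlapBound_nonneg {C : ℝ} (hC : 0 ≤ C) {σ : Matrix ι ι ℂ} (hσ : σ.PosSemidef)
    (k m : ℕ) : 0 ≤ overlapBound C σ k m := by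
  have hpow := re_trace_pow_nonneg hσ (2 * (k - m))
  unfold overlapBound
  positivity

theorem reverse_ofFn {α : Type*} (f : Fin k → α) :
    (List.ofFn f).reverse = List.ofFn (f ∘ Fin.rev) :=
  List.ext_getElem (by simp) fun p hp _ => by
    simp only [List.getElem_reverse, List.getElem_ofFn, List.length_ofFn, Function.comp_apply]
    congr 1
    ext
    simp only [Fin.val_rev]
    omega

theorem star_trace_list_prod {l : List (Matrix ι ι ℂ)} (hl : ∀ A ∈ l, A.IsHermitian) :
    star l.prod.trace = l.reverse.prod.trace := by
  rw [← trace_conjTranspose, conjTranspose_list_prod, List.map_congr_left hl, List.map_id']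

theorem im_uStatistic {X : Ω → Matrix ι ι ℂ} (hX : ∀ ω, (X ω).IsHermitian) (k : ℕ) (x : κ → Ω) :
    (uStatistic X k x).im = 0 := by
  rw [← Complex.conj_eq_iff_im]
  unfold uStatistic
  rw [map_mul, map_inv₀, map_natCast, map_sum]
  congr 1
  refine Fintype.sum_equiv (Equiv.embeddingCongr Fin.revPerm (Equiv.refl _)) _ _ fun i => ?_
  rw [starRingEnd_apply, star_trace_list_prod (by simp [hX]), reverse_ofFn]
  rfl

variable {X : Ω → Matrix ι ι ℂ} {σ : Matrix ι ι ℂ}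

theorem wordProd_univ_ofFn [DecidableEq κ] (i : Fin k → κ) (x : κ → Ω) :
    wordProd X σ Finset.univ (List.ofFn i) x = (List.ofFn fun a => X (x (i a))).prod := by
  simp only [wordProd, Finset.mem_univ, if_true, List.map_ofFn, Function.comp_def]

theorem re_uStatistic [DecidableEq κ] (σ : Matrix ι ι ℂ) (x : κ → Ω) :
    (uStatistic X k x).re = ((Fintype.card κ).descFactorial k : ℝ)⁻¹ *
      ∑ i : Fin k ↪ κ, (wordProd X σ Finset.univ (List.ofFn i) x).trace.re := by
  simp only [wordProd_univ_ofFn, uStatistic, ← Complex.re_sum]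
  rw [← Complex.re_ofReal_mul, Complex.ofReal_inv, Complex.ofReal_natCast]

variable [MeasurableSpace Ω] {μ : Measure Ω} [IsProbabilityMeasure μ] {C : ℝ}

theorem memLp_uStatistic (hX : EssBounded X μ) (k : ℕ) :
    MemLp (uStatistic X k) ⊤ (Measure.pi fun _ : κ => μ) := by
  classical
  have hword (i : Fin k ↪ κ) :
      MemLp (fun x => (List.ofFn fun a => X (x (i a))).prod.trace) ⊤ (Measure.pi fun _ => μ) := by
    simp only [← wordProd_univ_ofFn (σ := 0)]
    exact (essBounded_wordProd hX _ _).memLp_trace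
  exact (memLp_finsetSum _ fun i _ => hword i).const_mul _

theorem integral_re_uStatistic (hX : IsEstimator μ C X σ) (hk : k ≤ Fintype.card κ) :
    ∫ x, (uStatistic X k x).re ∂(Measure.pi fun _ : κ => μ) = (σ ^ k).trace.re := by
  classical
  simp only [re_uStatistic σ]
  rw [integral_const_mul, integral_finsetSum _ fun i _ =>
    (memLp_re_trace_wordProd hX.essBounded _ _).integrable le_top]
  have hword (i : Fin k ↪ κ) := integral_re_trace_wordProd_univ hX (List.nodup_ofFn.2 i.injective)
  simp only [hword, List.length_ofFn, Finset.sum_const, Finset.card_univ,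
    Fintype.card_embedding_eq, Fintype.card_fin, nsmul_eq_mul]
  exact inv_mul_cancel_left₀ (Nat.cast_ne_zero.2 (Nat.descFactorial_pos.2 hk).ne') _

theorem integral_uStatistic (hX : IsEstimator μ C X σ) (hherm : ∀ ω, (X ω).IsHermitian)
    (hσ : σ.PosSemidef) (hk : k ≤ Fintype.card κ) :
    ∫ x, uStatistic X k x ∂(Measure.pi fun _ : κ => μ) = (σ ^ k).trace := by
  have hre (x : κ → Ω) : uStatistic X k x = ((uStatistic X k x).re : ℂ) :=
    Complex.ext rfl (im_uStatistic hherm k x)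
  have hσre : (σ ^ k).trace = ((σ ^ k).trace.re : ℂ) :=
    Complex.ext rfl (Complex.nonneg_iff.1 (hσ.pow k).trace_nonneg).2.symm
  rw [integral_congr_ae (.of_forall hre), integral_complex_ofReal, integral_re_uStatistic hX hk,
    ← hσre]

theorem card_mul_covariance_le_overlapBound [DecidableEq κ] (hX : IsEstimator μ C X σ)
    (hσ : σ.PosSemidef) (hC : 0 ≤ C) (i j : Fin k ↪ κ) :
    Fintype.card ι * cov[fun x => (wordProd X σ Finset.univ (List.ofFn i) x).trace.re,
        fun x => (wordProd X σ Finset.univ (List.ofFn j) x).trace.re; Measure.pi fun _ => μ] ≤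
      overlapBound C σ k (Finset.univ.filter fun a => j a ∈ Finset.univ.map i).card := by
  have hnodup (i : Fin k ↪ κ) : (List.ofFn i).Nodup := List.nodup_ofFn.2 i.injective
  have hdisj : (List.ofFn i).Disjoint (List.ofFn j) ↔
      ((List.ofFn i).toFinset ∩ (List.ofFn j).toFinset).card = 0 := by
    rw [Finset.card_eq_zero, ← Finset.disjoint_iff_inter_eq_empty,
      List.disjoint_toFinset_iff_disjoint]
  rw [← card_toFinset_ofFn_inter, overlapBound]
  split_ifs with h <;> rw [← hdisj] at h
  · rw [covariance_re_trace_wordProd_of_disjoint hX (hnodup i) (hnodup j) h, mul_zero]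
  · simpa only [List.length_ofFn] using
      covariance_re_trace_wordProd_le hX hσ hC (hnodup i) (hnodup j) (by simp) h

theorem card_mul_variance_re_uStatistic_le (hX : IsEstimator μ C X σ) (hσ : σ.PosSemidef)
    (hC : 0 ≤ C) (hk : k ≤ Fintype.card κ) :
    Fintype.card ι * Var[fun x => (uStatistic X k x).re; Measure.pi fun _ : κ => μ] ≤
      ∑ m ∈ Finset.range (k + 1),
        k.choose m * (overlapBound C σ k m * ((k : ℝ) / Fintype.card κ) ^ m) := by
  classical
  set N : ℝ := ((Fintype.card κ).descFactorial k : ℝ) with hN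
  have hN0 : 0 < N := Nat.cast_pos.2 (Nat.descFactorial_pos.2 hk)
  set B := ∑ m ∈ Finset.range (k + 1),
    k.choose m * (overlapBound C σ k m * ((k : ℝ) / Fintype.card κ) ^ m)
  have hrow (i : Fin k ↪ κ) : ∑ j : Fin k ↪ κ,
      Fintype.card ι * cov[fun x => (wordProd X σ Finset.univ (List.ofFn i) x).trace.re,
        fun x => (wordProd X σ Finset.univ (List.ofFn j) x).trace.re; Measure.pi fun _ => μ] ≤
      N * B := by
    refine (Finset.sum_le_sum fun j _ =>
      card_mul_covariance_le_overlapBound hX hσ hC i j).trans ?_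
    simpa using
      sum_card_filter_mem_le (α := Fin k) (Finset.univ.map i) (overlapBound_nonneg hC hσ k)
  simp only [re_uStatistic σ]
  rw [variance_const_mul, variance_fun_sum fun i =>
    (memLp_re_trace_wordProd hX.essBounded _ _).mono_exponent le_top, ← hN, mul_left_comm,
    inv_pow, inv_mul_le_iff₀ (by positivity)]
  simp only [Finset.mul_sum]
  refine (Finset.sum_le_sum fun i _ => hrow i).trans_eq ?_
  rw [Finset.sum_const, Finset.card_univ, Fintype.card_embedding_eq, Fintype.card_fin, nsmul_eq_mul,
    ← hN, ← mul_assoc, sq]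

theorem sum_choose_mul_overlapBound_le (hσ : σ.PosSemidef) (hC : 1 ≤ C) {t : ℝ} (ht : 0 ≤ t)
    (k : ℕ) :
    ∑ m ∈ Finset.range (k + 1), k.choose m * (overlapBound C σ k m * t ^ m) ≤
      (2 * C) ^ k * ∑ j ∈ Finset.range k,
        (t * Fintype.card ι) ^ (k - j) * (σ ^ (2 * j)).trace.re := by
  rw [Finset.sum_range_succ', ← Finset.sum_range_reflect, Finset.mul_sum]
  simp only [overlapBound, if_true, zero_mul, mul_zero, add_zero]
  refine Finset.sum_le_sum fun j hj => ?_
  obtain ⟨hm, hkm⟩ : k - 1 - j + 1 = k - j ∧ k - (k - j) = j := by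
    have := Finset.mem_range.1 hj
    omega
  have hjk : k - j ≠ 0 := (Nat.sub_pos_of_lt (Finset.mem_range.1 hj)).ne'
  have hpow := re_trace_pow_nonneg hσ (2 * j)
  have hchoose : (k.choose (k - j) : ℝ) ≤ 2 ^ k := mod_cast Nat.choose_le_two_pow k (k - j)
  have hCpow : C ^ (k - j) ≤ C ^ k := pow_le_pow_right₀ hC (Nat.sub_le k j)
  rw [hm, if_neg hjk, hkm]
  calc (k.choose (k - j) : ℝ) *
        ((C * Fintype.card ι) ^ (k - j) * (σ ^ (2 * j)).trace.re * t ^ (k - j))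
      = k.choose (k - j) * C ^ (k - j) *
          ((t * Fintype.card ι) ^ (k - j) * (σ ^ (2 * j)).trace.re) := by ring
    _ ≤ 2 ^ k * C ^ k * ((t * Fintype.card ι) ^ (k - j) * (σ ^ (2 * j)).trace.re) := by gcongr
    _ = _ := by rw [mul_pow 2 C]

theorem variance_re_uStatistic_le [Nonempty ι] (hX : IsEstimator μ C X σ) (hσ : σ.PosSemidef)
    (hC : 1 ≤ C) (hk : k ≤ Fintype.card κ) :
    Var[fun x => (uStatistic X k x).re; Measure.pi fun _ : κ => μ] ≤
      (2 * C) ^ k / Fintype.card ι * ∑ j ∈ Finset.range k,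
        ((k : ℝ) * Fintype.card ι / Fintype.card κ) ^ (k - j) * (σ ^ (2 * j)).trace.re := by
  rw [div_mul_eq_mul_div, le_div_iff₀' (by positivity)]
  simp only [mul_div_right_comm (k : ℝ)]
  exact (card_mul_variance_re_uStatistic_le hX hσ (zero_le_one.trans hC) hk).trans
    (sum_choose_mul_overlapBound_le hσ hC (by positivity) k)

end UStatistic

section GaussianMoments

theorem integral_mul_fun_norm_of_homogeneous {E : Type*} [NormedAddCommGroup E] [NormedSpace ℝ E]
    [FiniteDimensional ℝ E] [MeasurableSpace E] [BorelSpace E] [Nontrivial E] (μ : Measure E)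
    [μ.IsAddHaarMeasure] {p : ℕ} {F : E → ℂ} (hF : ∀ (r : ℝ) x, F (r • x) = r ^ p * F x)
    (g : ℝ → ℂ) :
    ∫ x, F x * g ‖x‖ ∂μ = (∫ u : Metric.sphere (0 : E) 1, F u ∂μ.toSphere) *
      ∫ r in Set.Ioi (0 : ℝ), (r : ℂ) ^ (Module.finrank ℝ E - 1 + p) * g r := by
  have hpolar (x : ({0}ᶜ : Set E)) : F x * g ‖x.1‖ = F (homeomorphUnitSphereProd E x).1 *
      ((homeomorphUnitSphereProd E x).2 ^ p * g (homeomorphUnitSphereProd E x).2) := by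
    have hx : ‖x.1‖ • (homeomorphUnitSphereProd E x).1.1 = x := by
      simp [smul_smul, norm_ne_zero_iff.2 x.2]
    conv_lhs => rw [← hx, hF, hx]
    simp only [homeomorphUnitSphereProd_apply_snd_coe]
    ring
  calc ∫ x, F x * g ‖x‖ ∂μ = ∫ x : ({0}ᶜ : Set E), F x * g ‖x.1‖ ∂(μ.comap (↑)) := by
        rw [integral_subtype_comap (measurableSet_singleton _).compl fun x => F x * g ‖x‖,
          restrict_compl_singleton]
    _ = ∫ y, F y.1 * ((y.2 : ℝ) ^ p * g y.2)
          ∂μ.toSphere.prod (.volumeIoiPow (Module.finrank ℝ E - 1)) := by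
        simp only [hpolar]
        exact μ.measurePreserving_homeomorphUnitSphereProd.integral_comp
          (Homeomorph.measurableEmbedding _)
          fun y => F y.1 * (((y.2 : ℝ) : ℂ) ^ p * g y.2)
    _ = (∫ u : Metric.sphere (0 : E) 1, F u ∂μ.toSphere) * ∫ r : Set.Ioi (0 : ℝ), (r : ℝ) ^ p * g r
          ∂.volumeIoiPow (Module.finrank ℝ E - 1) :=
      integral_prod_mul (fun u : Metric.sphere (0 : E) 1 => F u)
        fun r : Set.Ioi (0 : ℝ) => ((r : ℝ) : ℂ) ^ p * g r
    _ = _ := by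
        simp only [Measure.volumeIoiPow, ENNReal.ofReal]
        rw [integral_withDensity_eq_integral_smul
            (measurable_subtype_coe.pow_const _).real_toNNReal,
          integral_subtype_comap measurableSet_Ioi fun r : ℝ =>
            Real.toNNReal (r ^ (Module.finrank ℝ E - 1)) • ((r : ℂ) ^ p * g r)]
        congr 1
        refine setIntegral_congr_fun measurableSet_Ioi fun r (hr : 0 < r) => ?_
        simp only [NNReal.smul_def, Real.coe_toNNReal _ (pow_nonneg hr.le _), Complex.real_smul]
        push_cast
        ring

theorem integral_Ioi_pow_mul_exp_neg_sq (m : ℕ) :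
    ∫ r in Set.Ioi (0 : ℝ), (r : ℂ) ^ (2 * m + 1) * Real.exp (-r ^ 2) =
      (m.factorial : ℂ) / 2 := by
  have h := integral_rpow_mul_exp_neg_rpow (p := 2) (q := (2 * m + 1 : ℕ)) two_pos
    (by linarith [((2 * m + 1 : ℕ).cast_nonneg : (0 : ℝ) ≤ _)])
  have hm : (((2 * m + 1 : ℕ) : ℝ) + 1) / 2 = m + 1 := by
    push_cast
    ring
  rw [hm, Real.Gamma_nat_eq_factorial] at h
  simp only [Real.rpow_natCast, Real.rpow_ofNat] at h
  calc _ = ∫ r in Set.Ioi (0 : ℝ), ((r ^ (2 * m + 1) * Real.exp (-r ^ 2) : ℝ) : ℂ) := by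
        simp only [Complex.ofReal_mul, Complex.ofReal_pow]
    _ = _ := by
        rw [integral_complex_ofReal, h]
        push_cast
        ring

theorem integral_norm_pow_mul_exp_neg_sq (p : ℕ) :
    ∫ z : ℂ, (‖z‖ : ℂ) ^ (2 * p) * Real.exp (-‖z‖ ^ 2) = Real.pi * p.factorial := by
  have h := Complex.integral_rpow_mul_exp_neg_rpow (p := 2) (q := (2 * p : ℕ)) one_le_two
    (by linarith [((2 * p : ℕ).cast_nonneg : (0 : ℝ) ≤ _)])
  have hp : (((2 * p : ℕ) : ℝ) + 2) / 2 = p + 1 := by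
    push_cast
    ring
  rw [hp, Real.Gamma_nat_eq_factorial, mul_div_cancel_left₀ _ two_ne_zero] at h
  simp only [Real.rpow_natCast, Real.rpow_ofNat] at h
  rw [← Complex.ofReal_natCast, ← Complex.ofReal_mul, ← h, ← integral_complex_ofReal]
  simp only [Complex.ofReal_mul, Complex.ofReal_pow]

theorem integral_pow_mul_star_pow_mul_exp_neg_sq (p q : ℕ) :
    ∫ z : ℂ, z ^ p * star z ^ q * Real.exp (-‖z‖ ^ 2) =
      if p = q then Real.pi * (p.factorial : ℂ) else 0 := by
  split_ifs with h
  · subst h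
    rw [← integral_norm_pow_mul_exp_neg_sq]
    congr 1 with z
    rw [← mul_pow, Complex.star_def, Complex.mul_conj', pow_mul]
  · have hpq : (p : ℂ) - q ≠ 0 := sub_ne_zero.2 (Nat.cast_injective.ne h)
    -- Rotating `z` by `ω` multiplies the integrand by `ω ^ (p - q) = -1`.
    set ω : Circle := Circle.exp (Real.pi / (p - q)) with hω
    have hpow : (ω : ℂ) ^ p * star (ω : ℂ) ^ q = -1 := by
      rw [Complex.star_def, ← Circle.coe_inv_eq_conj, Circle.coe_inv, hω, Circle.coe_exp,
        ← Complex.exp_neg, ← Complex.exp_nat_mul, ← Complex.exp_nat_mul, ← Complex.exp_add,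
        ← Complex.exp_pi_mul_I]
      congr 1
      push_cast
      field_simp
      ring
    have hrot := (rotation ω).measurePreserving.integral_comp
      (rotation ω).toHomeomorph.measurableEmbedding
      fun z : ℂ => z ^ p * star z ^ q * (Real.exp (-‖z‖ ^ 2) : ℂ)
    have hneg (z : ℂ) : (ω * z) ^ p * star (ω * z) ^ q * (Real.exp (-‖ω * z‖ ^ 2) : ℂ) =
        -(z ^ p * star z ^ q * (Real.exp (-‖z‖ ^ 2) : ℂ)) := by
      rw [norm_mul, Circle.norm_coe, one_mul, star_mul', mul_pow, mul_pow, mul_mul_mul_comm, hpow]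
      ring
    simp only [rotation_apply, hneg, integral_neg] at hrot
    exact self_eq_neg.1 hrot.symm

theorem prod_comp_eq_prod_pow_card {ι τ M : Type*} [Fintype ι] [DecidableEq ι] [Fintype τ]
    [CommMonoid M] (a : τ → ι) (x : ι → M) :
    ∏ t, x (a t) = ∏ i, x i ^ Fintype.card {t // a t = i} := by
  rw [← Finset.prod_fiberwise' Finset.univ a x]
  simp only [Finset.prod_const, Fintype.card_subtype]

theorem exists_integral_euclideanSpace_eq (ι : Type*) [Fintype ι] :
    ∃ c : ℝ, ∀ f : EuclideanSpace ℂ ι → ℂ,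
      ∫ x, f x = c * ∫ x : ι → ℂ, f (WithLp.toLp 2 x) := by
  let e := (PiLp.continuousLinearEquiv 2 ℂ fun _ : ι => ℂ).symm
  have : (Measure.map e volume).IsAddHaarMeasure := e.isAddHaarMeasure_map volume
  refine ⟨((volume : Measure (EuclideanSpace ℂ ι)).addHaarScalarFactor
    (Measure.map e volume) : ℝ), fun f => ?_⟩
  conv_lhs => rw [Measure.isAddLeftInvariant_eq_smul volume (Measure.map e volume)]
  rw [integral_smul_nnreal_measure]
  exact congrArg _ (e.toHomeomorph.measurableEmbedding.integral_map f)

variable {ι τ : Type*} [Fintype ι] [DecidableEq ι] [Fintype τ] [DecidableEq τ]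

theorem card_perm_comp_eq (a b : τ → ι) :
    Fintype.card {π : Equiv.Perm τ // a ∘ π = b} = ∏ i,
      if Fintype.card {t // a t = i} = Fintype.card {t // b t = i}
      then (Fintype.card {t // a t = i}).factorial else 0 := by
  by_cases h : ∃ π : Equiv.Perm τ, a ∘ π = b
  · obtain ⟨π₀, rfl⟩ := h
    have hfib (i : ι) : Fintype.card {t // a t = i} = Fintype.card {t // (a ∘ π₀) t = i} :=
      Fintype.card_congr (π₀.subtypeEquiv fun t => Iff.rfl).symm
    simp only [← hfib, if_true]
    rw [← DomMulAct.stabilizer_card a]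
    refine Fintype.card_congr ((Equiv.mulRight π₀⁻¹).subtypeEquiv fun π => ?_)
    rw [Equiv.coe_mulRight, Equiv.Perm.coe_mul, ← Function.comp_assoc]
    exact (Equiv.comp_symm_eq π₀ _ _).symm
  · have hfib : ∃ i, Fintype.card {t // a t = i} ≠ Fintype.card {t // b t = i} := by
      by_contra! hcard
      let e (i : ι) : {t // b t = i} ≃ {t // a t = i} := Fintype.equivOfCardEq (hcard i).symm
      exact h ⟨Equiv.ofFiberEquiv e, funext (Equiv.ofFiberEquiv_map e)⟩
    obtain ⟨i, hi⟩ := hfib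
    rw [Finset.prod_eq_zero (Finset.mem_univ i) (if_neg hi), Fintype.card_eq_zero_iff]
    exact ⟨fun π => h ⟨π, π.2⟩⟩

theorem integral_prod_mul_star_mul_exp_neg_sq (a b : τ → ι) :
    ∫ x : ι → ℂ, (∏ t, x (a t) * star (x (b t))) * Real.exp (-∑ i, ‖x i‖ ^ 2) =
      Real.pi ^ Fintype.card ι * Fintype.card {π : Equiv.Perm τ // a ∘ π = b} := by
  have hprod (x : ι → ℂ) : (∏ t, x (a t) * star (x (b t))) * Real.exp (-∑ i, ‖x i‖ ^ 2) =
      ∏ i, x i ^ Fintype.card {t // a t = i} * star (x i) ^ Fintype.card {t // b t = i} *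
        Real.exp (-‖x i‖ ^ 2) := by
    rw [Finset.prod_mul_distrib, prod_comp_eq_prod_pow_card a,
      prod_comp_eq_prod_pow_card b fun i => star (x i), Finset.prod_mul_distrib,
      Finset.prod_mul_distrib, ← Finset.sum_neg_distrib, Real.exp_sum, Complex.ofReal_prod]
  simp only [hprod]
  rw [integral_fintype_prod_volume_eq_prod fun i (z : ℂ) => z ^ Fintype.card {t // a t = i} *
    star z ^ Fintype.card {t // b t = i} * (Real.exp (-‖z‖ ^ 2) : ℂ), card_perm_comp_eq]
  simp only [integral_pow_mul_star_pow_mul_exp_neg_sq, ← mul_ite_zero, Finset.prod_mul_distrib,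
    Finset.prod_const, Finset.card_univ]
  push_cast
  rfl

end GaussianMoments

section HaarMoments

instance isProbabilityMeasure_haarUnit {d : ℕ} [NeZero d] : IsProbabilityMeasure (haarUnit d) := by
  refine ⟨?_⟩
  rw [haarUnit, Measure.smul_apply, smul_eq_mul]
  exact ENNReal.inv_mul_cancel (Measure.measure_univ_ne_zero.2 (Measure.toSphere_ne_zero _))
    (measure_ne_top _ _)

theorem exists_integral_toSphere_prod_mul_star (d : ℕ) [NeZero d] :
    ∃ c : ℂ, ∀ (m : ℕ) (a b : Fin m → Fin d),
      ((d + m - 1).factorial : ℂ) *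
          ∫ u : UnitVec d, ∏ t, u.1 (a t) * star (u.1 (b t)) ∂(volume :
            Measure (EuclideanSpace ℂ (Fin d))).toSphere =
        c * Fintype.card {π : Equiv.Perm (Fin m) // a ∘ π = b} := by
  obtain ⟨c, hc⟩ := exists_integral_euclideanSpace_eq (Fin d)
  refine ⟨2 * c * Real.pi ^ d, fun m a b => ?_⟩
  have hgauss := hc fun x => (∏ t, x (a t) * star (x (b t))) * (Real.exp (-‖x‖ ^ 2) : ℂ)
  simp only [EuclideanSpace.norm_sq_eq] at hgauss
  rw [integral_prod_mul_star_mul_exp_neg_sq, Fintype.card_fin] at hgauss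
  have hhom (r : ℝ) (x : EuclideanSpace ℂ (Fin d)) :
      ∏ t, (r • x) (a t) * star ((r • x) (b t)) =
        (r : ℂ) ^ (2 * m) * ∏ t, x (a t) * star (x (b t)) := by
    simp only [PiLp.smul_apply, Complex.real_smul, star_mul', Complex.star_def, Complex.conj_ofReal,
      mul_mul_mul_comm (r : ℂ), Finset.prod_mul_distrib, Finset.prod_const, Finset.card_univ,
      Fintype.card_fin]
    ring
  have hpolar := integral_mul_fun_norm_of_homogeneous volume
    (F := fun x : EuclideanSpace ℂ (Fin d) => ∏ t, x (a t) * star (x (b t))) hhom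
    fun r => (Real.exp (-r ^ 2) : ℂ)
  have hd := NeZero.pos d
  have hdim : Module.finrank ℝ (EuclideanSpace ℂ (Fin d)) - 1 + 2 * m =
      2 * (d + m - 1) + 1 := by
    rw [finrank_real_of_complex, finrank_euclideanSpace, Fintype.card_fin]
    omega
  rw [hdim, integral_Ioi_pow_mul_exp_neg_sq] at hpolar
  simp only [EuclideanSpace.norm_sq_eq] at hpolar
  rw [hgauss] at hpolar
  linear_combination -2 * hpolar

theorem integral_prod_mul_star_haarUnit {d : ℕ} [NeZero d] {m : ℕ} (a b : Fin m → Fin d) :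
    ∫ u, ∏ t, u.1 (a t) * star (u.1 (b t)) ∂haarUnit d =
      (d.ascFactorial m : ℂ)⁻¹ * Fintype.card {π : Equiv.Perm (Fin m) // a ∘ π = b} := by
  obtain ⟨c, hc⟩ := exists_integral_toSphere_prod_mul_star d
  set S := (volume : Measure (EuclideanSpace ℂ (Fin d))).toSphere with hS
  have hmass : ((d - 1).factorial : ℂ) * S.real Set.univ = c := by
    have hperm : Fintype.card {π : Equiv.Perm (Fin 0) // (Fin.elim0 : Fin 0 → Fin d) ∘ π =
        Fin.elim0} = 1 :=
      Fintype.card_congr (Equiv.subtypeUnivEquiv fun π => Subsingleton.elim _ _)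
    simpa [hperm] using hc 0 Fin.elim0 Fin.elim0
  have hfac : ((d - 1).factorial : ℂ) * d.ascFactorial m = (d + m - 1).factorial := by
    exact_mod_cast Nat.factorial_mul_ascFactorial' d m (NeZero.pos d)
  have hS0 : (S.real Set.univ : ℂ) ≠ 0 := by
    rw [Complex.ofReal_ne_zero, measureReal_ne_zero_iff]
    exact Measure.measure_univ_ne_zero.2 (Measure.toSphere_ne_zero _)
  have hfac0 : ((d - 1).factorial : ℂ) * d.ascFactorial m ≠ 0 :=
    hfac.trans_ne (Nat.cast_ne_zero.2 (Nat.factorial_ne_zero _))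
  have hd0 := left_ne_zero_of_mul hfac0
  have hasc := right_ne_zero_of_mul hfac0
  have h := hc m a b
  rw [haarUnit, integral_smul_measure, ← hS, ENNReal.toReal_inv, ← measureReal_def,
    Complex.real_smul, Complex.ofReal_inv]
  rw [← hfac, ← hmass] at h
  field_simp
  exact mul_left_cancel₀ hd0 (by linear_combination h)

theorem integral_prod_braket {d : ℕ} [NeZero d] {m : ℕ}
    (A : Fin m → Matrix (Fin d) (Fin d) ℂ) :
    ∫ u, ∏ t, braket (A t) u ∂haarUnit d = (d.ascFactorial m : ℂ)⁻¹ *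
      ∑ π : Equiv.Perm (Fin m), ∑ j : Fin m → Fin d, ∏ t, A t (j (π t)) (j t) := by
  have hexpand (u : UnitVec d) : ∏ t, braket (A t) u = ∑ i : Fin m → Fin d, ∑ j : Fin m → Fin d,
      (∏ t, A t (i t) (j t)) * ∏ t, u.1 (j t) * star (u.1 (i t)) := by
    simp only [braket, Finset.prod_univ_sum, Fintype.piFinset_univ, ← Finset.prod_mul_distrib]
    exact Finset.sum_congr rfl fun i _ => Finset.sum_congr rfl fun j _ =>
      Finset.prod_congr rfl fun t _ => by ring
  have hint (c : ℂ) (a b : Fin m → Fin d) :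
      Integrable (fun u => c * ∏ t, u.1 (a t) * star (u.1 (b t))) (haarUnit d) :=
    Continuous.integrable_of_hasCompactSupport (by fun_prop) (HasCompactSupport.of_compactSpace _)
  have hperm (i j : Fin m → Fin d) :
      (Fintype.card {π : Equiv.Perm (Fin m) // j ∘ π = i} : ℂ) =
        ∑ π : Equiv.Perm (Fin m), if j ∘ π = i then 1 else 0 := by
    rw [Fintype.card_subtype, Finset.sum_boole]
  simp only [hexpand]
  rw [integral_finsetSum _ fun i _ => integrable_finsetSum _ fun _ _ => hint _ _ _]
  simp only [integral_finsetSum _ fun _ _ => hint _ _ _, integral_const_mul,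
    integral_prod_mul_star_haarUnit, hperm]
  simp only [Finset.mul_sum]
  rw [Finset.sum_congr rfl fun i _ => Finset.sum_comm, Finset.sum_comm]
  refine Finset.sum_congr rfl fun π _ => ?_
  rw [Finset.sum_comm]
  refine Finset.sum_congr rfl fun j _ => ?_
  simp only [mul_ite, mul_one, mul_zero, Finset.sum_ite_eq, Finset.mem_univ, if_true,
    Function.comp_apply]
  ring

theorem sum_fin_three_arrow {α M : Type*} [Fintype α] [AddCommMonoid M] (f : (Fin 3 → α) → M) :
    ∑ j, f j = ∑ x, ∑ y, ∑ z, f ![x, y, z] := by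
  rw [← (Fin.consEquiv fun _ => α).sum_comp, Fintype.sum_prod_type]
  refine Finset.sum_congr rfl fun x _ => ?_
  rw [← (finTwoArrowEquiv α).symm.sum_comp, Fintype.sum_prod_type]
  rfl

theorem sum_perm_fin_three {M : Type*} [AddCommMonoid M] (f : Equiv.Perm (Fin 3) → M) :
    ∑ π, f π = f 1 + f (Equiv.swap 0 1) + f (Equiv.swap 0 2) + f (Equiv.swap 1 2) +
      f (finRotate 3) + f (finRotate 3)⁻¹ := by
  have huniv : (Finset.univ : Finset (Equiv.Perm (Fin 3))) = {1, Equiv.swap 0 1, Equiv.swap 0 2,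
      Equiv.swap 1 2, finRotate 3, (finRotate 3)⁻¹} := by decide
  rw [huniv]
  repeat rw [Finset.sum_insert (by decide)]
  rw [Finset.sum_singleton]
  simp only [add_assoc]

theorem sum_perm_fin_three_eq_trace {ι R : Type*} [Fintype ι] [CommRing R] (A B C : Matrix ι ι R) :
    ∑ π : Equiv.Perm (Fin 3), ∑ j : Fin 3 → ι, ∏ t, ![A, B, C] t (j (π t)) (j t) =
      A.trace * B.trace * C.trace + (A * B).trace * C.trace + (A * C).trace * B.trace +
        A.trace * (B * C).trace + (A * C * B).trace + (A * B * C).trace := by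
  have hone : ∑ x, ∑ y, ∑ z, A x x * B y y * C z z = A.trace * B.trace * C.trace := by
    simp only [trace, diag_apply, ← Finset.mul_sum, ← Finset.sum_mul]
  have hAB : ∑ x, ∑ y, ∑ z, A y x * B x y * C z z = (A * B).trace * C.trace := by
    simp only [trace, diag_apply, mul_apply, ← Finset.mul_sum, ← Finset.sum_mul]
    rw [Finset.sum_comm]
  have hAC : ∑ x, ∑ y, ∑ z, A z x * B y y * C x z = (A * C).trace * B.trace := by
    simp only [trace, diag_apply, mul_apply, mul_right_comm _ (B _ _), ← Finset.sum_mul]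
    simp only [← Finset.mul_sum, ← Finset.sum_mul]
    rw [Finset.sum_comm]
  have hBC : ∑ x, ∑ y, ∑ z, A x x * B z y * C y z = A.trace * (B * C).trace := by
    simp only [trace, diag_apply, mul_apply, mul_assoc, ← Finset.mul_sum, ← Finset.sum_mul]
    rw [Finset.sum_comm (f := fun y z => B z y * C y z)]
  have hACB : ∑ x, ∑ y, ∑ z, A y x * B z y * C x z = (A * C * B).trace := by
    rw [trace_mul_cycle, trace_mul_cycle]
    simp only [trace, diag_apply, mul_apply, Finset.sum_mul]
    exact Finset.sum_congr rfl fun x _ => Finset.sum_congr rfl fun y _ =>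
      Finset.sum_congr rfl fun z _ => by ring
  have hABC : ∑ x, ∑ y, ∑ z, A z x * B x y * C y z = (A * B * C).trace := by
    rw [trace_mul_cycle, trace_mul_cycle]
    simp only [trace, diag_apply, mul_apply, Finset.sum_mul]
    refine Finset.sum_congr rfl fun x _ => Finset.sum_comm.trans ?_
    exact Finset.sum_congr rfl fun z _ => Finset.sum_congr rfl fun y _ => by ring
  rw [sum_perm_fin_three]
  simp only [sum_fin_three_arrow, Fin.prod_univ_three]
  rw [← hone, ← hAB, ← hAC, ← hBC, ← hACB, ← hABC]
  rfl

theorem integral_braket_mul_braket_mul_braket {d : ℕ} [NeZero d]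
    (A B C : Matrix (Fin d) (Fin d) ℂ) :
    ∫ u, braket A u * braket B u * braket C u ∂haarUnit d =
      ((d : ℂ) * (d + 1) * (d + 2))⁻¹ *
        (A.trace * B.trace * C.trace + (A * B).trace * C.trace + (A * C).trace * B.trace +
          A.trace * (B * C).trace + (A * C * B).trace + (A * B * C).trace) := by
  have h := integral_prod_braket ![A, B, C]
  rw [sum_perm_fin_three_eq_trace] at h
  simp only [Fin.prod_univ_three, cons_val] at h
  rw [h]
  simp only [Nat.ascFactorial]
  push_cast
  ring

end HaarMoments

section ConditionedPOVM

variable {d : ℕ}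

theorem braket_eq_dotProduct (M : Matrix (Fin d) (Fin d) ℂ) (u : UnitVec d) :
    braket M u = star (WithLp.ofLp u.1) ⬝ᵥ M *ᵥ WithLp.ofLp u.1 := by
  simp only [braket, dotProduct, mulVec, Finset.mul_sum, Pi.star_apply, mul_assoc]

theorem braket_nonneg {M : Matrix (Fin d) (Fin d) ℂ} (hM : M.PosSemidef) (u : UnitVec d) :
    0 ≤ braket M u :=
  (hM.dotProduct_mulVec_nonneg _).trans_eq (braket_eq_dotProduct M u).symm

theorem braket_add (A B : Matrix (Fin d) (Fin d) ℂ) (u : UnitVec d) :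
    braket (A + B) u = braket A u + braket B u := by
  simp only [braket_eq_dotProduct, add_mulVec, dotProduct_add]

theorem braket_smul (r : ℂ) (A : Matrix (Fin d) (Fin d) ℂ) (u : UnitVec d) :
    braket (r • A) u = r * braket A u := by
  simp only [braket_eq_dotProduct, smul_mulVec, dotProduct_smul, smul_eq_mul]

theorem braket_one (u : UnitVec d) : braket 1 u = 1 := by
  have hu : ‖u.1‖ = 1 := norm_eq_of_mem_sphere u
  rw [braket_eq_dotProduct, one_mulVec, dotProduct_comm, ← EuclideanSpace.inner_eq_star_dotProduct,
    inner_self_eq_norm_sq_to_K, hu]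
  simp

theorem continuous_braket (M : Matrix (Fin d) (Fin d) ℂ) : Continuous (braket M) := by
  unfold braket
  fun_prop

theorem trace_mul_ketbra (A : Matrix (Fin d) (Fin d) ℂ) (u : UnitVec d) :
    (A * ketbra u).trace = braket A u := by
  simp only [trace, diag_apply, mul_apply, ketbra, of_apply, braket]
  exact Finset.sum_congr rfl fun i _ => Finset.sum_congr rfl fun j _ => by ring

theorem ketbra_mul_mul_ketbra (D : Matrix (Fin d) (Fin d) ℂ) (u : UnitVec d) :
    ketbra u * D * ketbra u = braket D u • ketbra u := by
  ext p q
  simp only [mul_apply, ketbra, of_apply, braket, Matrix.smul_apply, smul_eq_mul,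
    Finset.sum_mul]
  rw [Finset.sum_comm]
  exact Finset.sum_congr rfl fun i _ => Finset.sum_congr rfl fun j _ => by ring

variable {σ Q ρ : Matrix (Fin d) (Fin d) ℂ}

theorem IsDensityMatrix.neZero (hρ : IsDensityMatrix ρ) : NeZero d :=
  ⟨by
    rintro rfl
    simpa [trace] using hρ.trace_eq_one⟩

theorem posSemidef_of_isStarProjection (hQ : IsStarProjection Q) : Q.PosSemidef := by
  have h := posSemidef_conjTranspose_mul_self Q
  rwa [← star_eq_conjTranspose, hQ.isSelfAdjoint.star_eq, hQ.isIdempotentElem.eq] at h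

theorem posSemidef_subState (hρ : IsDensityMatrix ρ) (hQ : IsStarProjection Q) :
    (subState Q ρ).PosSemidef := by
  have h := hρ.posSemidef.mul_mul_conjTranspose_same (1 - Q)
  rwa [← star_eq_conjTranspose, hQ.one_sub.isSelfAdjoint.star_eq] at h

theorem trace_subState (hQ : IsStarProjection Q) :
    (subState Q ρ).trace = ((1 - Q) * ρ).trace := by
  rw [subState, trace_mul_comm, ← Matrix.mul_assoc, hQ.one_sub.isIdempotentElem.eq]

theorem re_trace_mul_nonneg (hρ : IsDensityMatrix ρ) (hQ : IsStarProjection Q) :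
    0 ≤ (Q * ρ).trace.re :=
  (Complex.nonneg_iff.1 (trace_mul_nonneg (posSemidef_of_isStarProjection hQ) hρ.posSemidef)).1

theorem re_trace_mul_add_re_trace_subState (hρ : IsDensityMatrix ρ) (hQ : IsStarProjection Q) :
    (Q * ρ).trace.re + (subState Q ρ).trace.re = 1 := by
  rw [trace_subState hQ, Matrix.sub_mul, Matrix.one_mul, trace_sub, hρ.trace_eq_one,
    Complex.sub_re, add_sub_cancel, Complex.one_re]

theorem integral_uniformPOVM (hσ : σ.PosSemidef) (g : UnitVec d → ℂ) :
    ∫ u, g u ∂uniformPOVM σ = ∫ u, (d : ℂ) * braket σ u * g u ∂haarUnit d := by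
  have hmeas : Measurable fun u => ENNReal.ofReal ((d : ℝ) * (braket σ u).re) :=
    (measurable_const.mul
      (Complex.measurable_re.comp (continuous_braket σ).measurable)).ennreal_ofReal
  rw [uniformPOVM, integral_withDensity_eq_integral_toReal_smul hmeas
    (Filter.Eventually.of_forall fun u => ENNReal.ofReal_lt_top)]
  congr 1 with u
  obtain ⟨hre, him⟩ := Complex.nonneg_iff.1 (braket_nonneg hσ u)
  have hbraket : ((braket σ u).re : ℂ) = braket σ u := Complex.ext rfl him
  rw [ENNReal.toReal_ofReal (by positivity), Complex.real_smul, Complex.ofReal_mul, hbraket,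
    Complex.ofReal_natCast]

theorem smul_uniformPOVM (hσ : σ.PosSemidef) :
    ENNReal.ofReal σ.trace.re • uniformPOVM (σ.trace⁻¹ • σ) = uniformPOVM σ := by
  obtain ⟨hnonneg, him⟩ := Complex.nonneg_iff.1 hσ.trace_nonneg
  have htrace : (σ.trace.re : ℂ) = σ.trace := Complex.ext rfl him
  rcases eq_or_ne σ.trace 0 with h0 | h0
  · rw [hσ.trace_eq_zero_iff.1 h0]
    simp [uniformPOVM, braket]
  · have hre : σ.trace.re ≠ 0 := fun h => h0 (by rw [← htrace, h, Complex.ofReal_zero])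
    rw [uniformPOVM, uniformPOVM, ← withDensity_smul' _ _ ENNReal.ofReal_ne_top]
    congr 1 with u
    rw [Pi.smul_apply, smul_eq_mul, ← ENNReal.ofReal_mul hnonneg, braket_smul, ← htrace,
      ← Complex.ofReal_inv, Complex.re_ofReal_mul, Complex.ofReal_re, mul_left_comm,
      mul_inv_cancel_left₀ hre]

theorem conditionedPOVM_eq (hρ : IsDensityMatrix ρ) (hQ : IsStarProjection Q) :
    conditionedPOVM Q ρ = ENNReal.ofReal (Q * ρ).trace.re • Measure.dirac (Sum.inl ()) +
      (uniformPOVM (subState Q ρ)).map Sum.inr := by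
  rw [conditionedPOVM, ← trace_subState hQ, ← Measure.map_smul,
    smul_uniformPOVM (posSemidef_subState hρ hQ)]

theorem integral_conditionedPOVM (hρ : IsDensityMatrix ρ) (hQ : IsStarProjection Q)
    {g : Outcome d → ℂ} (hg : Integrable g (conditionedPOVM Q ρ)) (hbot : g (Sum.inl ()) = 0) :
    ∫ x, g x ∂conditionedPOVM Q ρ =
      ∫ u, (d : ℂ) * braket (subState Q ρ) u * g (Sum.inr u) ∂haarUnit d := by
  have hinl : MeasurableEmbedding (Sum.inl : Unit → Outcome d) :=
    ⟨Sum.inl_injective, measurable_inl, fun _ hs => hs.inl_image⟩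
  have hinr : MeasurableEmbedding (Sum.inr : UnitVec d → Outcome d) :=
    ⟨Sum.inr_injective, measurable_inr, fun _ hs => hs.inr_image⟩
  rw [conditionedPOVM_eq hρ hQ] at hg ⊢
  rw [integral_add_measure hg.left_of_add_measure hg.right_of_add_measure, integral_smul_measure,
    ← Measure.map_dirac' measurable_inl, hinl.integral_map, integral_dirac, hbot,
    smul_zero, zero_add, hinr.integral_map,
    integral_uniformPOVM (posSemidef_subState hρ hQ)]

variable [NeZero d]

theorem integral_braket_mul_braket (A B : Matrix (Fin d) (Fin d) ℂ) :
    ∫ u, braket A u * braket B u ∂haarUnit d =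
      ((d : ℂ) * (d + 1))⁻¹ * (A.trace * B.trace + (A * B).trace) := by
  have h := integral_braket_mul_braket_mul_braket A B 1
  simp only [braket_one, mul_one, trace_one, Fintype.card_fin] at h
  have hd1 : (d : ℂ) + 1 ≠ 0 := Nat.cast_add_one_ne_zero d
  have hd2 : (d : ℂ) + 2 ≠ 0 := by exact_mod_cast (d + 1).succ_ne_zero
  rw [h]
  field

theorem integral_braket (A : Matrix (Fin d) (Fin d) ℂ) :
    ∫ u, braket A u ∂haarUnit d = (d : ℂ)⁻¹ * A.trace := by
  have h := integral_braket_mul_braket A 1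
  simp only [braket_one, mul_one, trace_one, Fintype.card_fin] at h
  have hd1 : (d : ℂ) + 1 ≠ 0 := Nat.cast_add_one_ne_zero d
  rw [h]
  field

theorem integrable_re_braket (σ : Matrix (Fin d) (Fin d) ℂ) :
    Integrable (fun u => (d : ℝ) * (braket σ u).re) (haarUnit d) :=
  (continuous_const.mul (Complex.continuous_re.comp
    (continuous_braket σ))).integrable_of_hasCompactSupport (HasCompactSupport.of_compactSpace _)

instance isFiniteMeasure_uniformPOVM : IsFiniteMeasure (uniformPOVM σ) :=
  isFiniteMeasure_withDensity_ofReal (integrable_re_braket σ).2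

theorem uniformPOVM_univ (hσ : σ.PosSemidef) :
    uniformPOVM σ Set.univ = ENNReal.ofReal σ.trace.re := by
  have h := integral_uniformPOVM hσ fun _ => 1
  simp only [integral_const, mul_one, integral_const_mul, integral_braket] at h
  rw [mul_inv_cancel_left₀ (Nat.cast_ne_zero.2 (NeZero.ne d))] at h
  rw [← h, Complex.real_smul, mul_one, Complex.ofReal_re, ofReal_measureReal]

theorem isProbabilityMeasure_conditionedPOVM (hρ : IsDensityMatrix ρ) (hQ : IsStarProjection Q) :
    IsProbabilityMeasure (conditionedPOVM Q ρ) := by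
  refine ⟨?_⟩
  have hσ := posSemidef_subState hρ hQ
  rw [conditionedPOVM_eq hρ hQ, Measure.add_apply, Measure.smul_apply, measure_univ, smul_eq_mul,
    mul_one, Measure.map_apply measurable_inr MeasurableSet.univ, Set.preimage_univ,
    uniformPOVM_univ hσ, ← ENNReal.ofReal_add (re_trace_mul_nonneg hρ hQ)
      (Complex.nonneg_iff.1 hσ.trace_nonneg).1,
    re_trace_mul_add_re_trace_subState hρ hQ, ENNReal.ofReal_one]

end ConditionedPOVM

section SingleCopy

variable {d : ℕ} {Q ρ : Matrix (Fin d) (Fin d) ℂ}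

theorem isHermitian_singleEstimator (x : Outcome d) : (singleEstimator x).IsHermitian := by
  cases x with
  | inl _ => exact isHermitian_zero
  | inr u =>
    have hk : (ketbra u).IsHermitian := by
      ext p q
      simp [ketbra, mul_comm]
    have hd : IsSelfAdjoint ((d : ℂ) + 1) := by simp [isSelfAdjoint_iff]
    exact (hk.smul hd).sub isHermitian_one

theorem essBounded_singleEstimator (μ : Measure (Outcome d)) [IsFiniteMeasure μ] :
    EssBounded singleEstimator μ := fun p q => by
  have hcont : Continuous fun u : UnitVec d => singleEstimator (Sum.inr u) p q := by
    simp only [singleEstimator, ketbra, Matrix.sub_apply, Matrix.smul_apply, of_apply]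
    fun_prop
  obtain ⟨C, hC⟩ := isCompact_univ.exists_bound_of_continuousOn hcont.continuousOn
  have hmeas : Measurable fun x : Outcome d => singleEstimator x p q :=
    measurable_fun_sum measurable_const hcont.measurable
  refine memLp_top_of_bound hmeas.aestronglyMeasurable (max C 0) (.of_forall ?_)
  rintro (_ | u)
  · simp [singleEstimator]
  · exact (hC u (Set.mem_univ u)).trans (le_max_left C 0)

/-- The observable whose quadratic form at `u` is `tr (A ((d + 1) |u⟩⟨u| - 1))`. -/
def dualObservable (A : Matrix (Fin d) (Fin d) ℂ) : Matrix (Fin d) (Fin d) ℂ :=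
  ((d : ℂ) + 1) • A + (-A.trace) • 1

theorem trace_mul_singleEstimator_inr (A : Matrix (Fin d) (Fin d) ℂ) (u : UnitVec d) :
    (A * singleEstimator (Sum.inr u)).trace = braket (dualObservable A) u := by
  rw [dualObservable, braket_add, braket_smul, braket_smul, braket_one, singleEstimator,
    Matrix.mul_sub, mul_smul_comm, trace_sub, trace_smul, trace_mul_ketbra, Matrix.mul_one,
    smul_eq_mul]
  ring

theorem trace_sandwich_singleEstimator_inr (Z D : Matrix (Fin d) (Fin d) ℂ) (u : UnitVec d) :
    (Z * singleEstimator (Sum.inr u) * D * singleEstimator (Sum.inr u)).trace =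
      ((d : ℂ) + 1) ^ 2 * (braket Z u * braket D u) +
        braket ((-((d : ℂ) + 1)) • (D * Z + Z * D) + (Z * D).trace • 1) u := by
  have hketbra : (Z * ketbra u * D * ketbra u).trace = braket Z u * braket D u := by
    rw [Matrix.mul_assoc, Matrix.mul_assoc, ← Matrix.mul_assoc (ketbra u), ketbra_mul_mul_ketbra,
      mul_smul_comm, trace_smul, trace_mul_ketbra, smul_eq_mul, mul_comm]
  have hcycle : (Z * ketbra u * D).trace = braket (D * Z) u := by
    rw [trace_mul_comm, ← Matrix.mul_assoc, trace_mul_ketbra]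
  simp only [singleEstimator, braket_add, braket_smul, braket_one, Matrix.mul_sub, Matrix.sub_mul,
    Matrix.mul_one, mul_smul_comm, smul_mul_assoc, trace_sub, trace_smul, hketbra, hcycle,
    trace_mul_ketbra, smul_eq_mul]
  ring

theorem norm_sq_trace_singleEstimator_mul (B : Matrix (Fin d) (Fin d) ℂ) (x : Outcome d) :
    ((‖(singleEstimator x * B).trace‖ ^ 2 : ℝ) : ℂ) =
      (Bᴴ * singleEstimator x).trace * (B * singleEstimator x).trace := by
  have hstar : (Bᴴ * singleEstimator x).trace = star (singleEstimator x * B).trace := by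
    rw [← trace_conjTranspose, conjTranspose_mul, (isHermitian_singleEstimator x).eq]
  rw [hstar, trace_mul_comm B, Complex.star_def, Complex.conj_mul', Complex.ofReal_pow]

theorem norm_sq_pow_mul_singleEstimator_mul {σ : Matrix (Fin d) (Fin d) ℂ} (hσ : σ.IsHermitian)
    (a : ℕ) (B : Matrix (Fin d) (Fin d) ℂ) (x : Outcome d) :
    ((‖σ ^ a * singleEstimator x * B‖ ^ 2 : ℝ) : ℂ) =
      (σ ^ (2 * a) * singleEstimator x * (B * Bᴴ) * singleEstimator x).trace := by
  rw [← trace_conjTranspose_mul_self, conjTranspose_mul, conjTranspose_mul, conjTranspose_pow,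
    hσ.eq, (isHermitian_singleEstimator x).eq, Matrix.mul_assoc, trace_mul_comm, two_mul, pow_add,
    trace_mul_comm _ (singleEstimator x)]
  simp only [Matrix.mul_assoc]

theorem trace_subState_le_one (hρ : IsDensityMatrix ρ) (hQ : IsStarProjection Q) :
    (subState Q ρ).trace ≤ 1 := by
  rw [trace_subState hQ, Matrix.sub_mul, Matrix.one_mul, trace_sub, hρ.trace_eq_one]
  exact sub_le_self 1 (trace_mul_nonneg (posSemidef_of_isStarProjection hQ) hρ.posSemidef)

theorem trace_subState_mul_le (hρ : IsDensityMatrix ρ) (hQ : IsStarProjection Q)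
    {M : Matrix (Fin d) (Fin d) ℂ} (hM : M.PosSemidef) :
    (subState Q ρ * M).trace ≤ M.trace := by
  have hσ := posSemidef_subState hρ hQ
  obtain ⟨htr, him⟩ := Complex.nonneg_iff.1 hM.trace_nonneg
  refine Complex.le_def.2 ⟨(re_trace_mul_le hσ hM).trans
    (mul_le_of_le_one_left htr (Complex.le_def.1 (trace_subState_le_one hρ hQ)).1), ?_⟩
  rw [← him, ← (Complex.nonneg_iff.1 (trace_mul_nonneg hσ hM)).2]

theorem integral_trace_mul_singleEstimator (hρ : IsDensityMatrix ρ) (hQ : IsStarProjection Q)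
    (A : Matrix (Fin d) (Fin d) ℂ) :
    ∫ x, (A * singleEstimator x).trace ∂conditionedPOVM Q ρ = (A * subState Q ρ).trace := by
  have := hρ.neZero
  have := isProbabilityMeasure_conditionedPOVM hρ hQ
  have hbdd := (EssBounded.const A).mul (essBounded_singleEstimator (conditionedPOVM Q ρ))
  rw [integral_conditionedPOVM hρ hQ (hbdd.memLp_trace.integrable le_top)
    (by simp [singleEstimator])]
  simp only [trace_mul_singleEstimator_inr, mul_assoc]
  rw [integral_const_mul, integral_braket_mul_braket, trace_mul_comm A]
  simp only [dualObservable, mul_add, trace_add, trace_smul, mul_smul_comm, Matrix.mul_one,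
    trace_one, Fintype.card_fin, smul_eq_mul]
  have hd : (d : ℂ) ≠ 0 := Nat.cast_ne_zero.2 (NeZero.ne d)
  have hd1 : (d : ℂ) + 1 ≠ 0 := Nat.cast_add_one_ne_zero d
  field_simp
  ring

theorem integral_trace_mul_trace_singleEstimator (hρ : IsDensityMatrix ρ)
    (hQ : IsStarProjection Q) (A B : Matrix (Fin d) (Fin d) ℂ) :
    ((d : ℂ) + 2) * ∫ x, (A * singleEstimator x).trace * (B * singleEstimator x).trace
        ∂conditionedPOVM Q ρ =
      (d + 1) * ((subState Q ρ).trace * (A * B).trace + (subState Q ρ * A * B).trace +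
          (subState Q ρ * B * A).trace) -
        ((subState Q ρ).trace * A.trace * B.trace + (subState Q ρ * A).trace * B.trace +
          A.trace * (subState Q ρ * B).trace) := by
  have := hρ.neZero
  have := isProbabilityMeasure_conditionedPOVM hρ hQ
  have hX := essBounded_singleEstimator (conditionedPOVM Q ρ)
  have hbdd (C : Matrix (Fin d) (Fin d) ℂ) := ((EssBounded.const C).mul hX).memLp_trace
  have hint : Integrable (fun x => (A * singleEstimator x).trace * (B * singleEstimator x).trace)
      (conditionedPOVM Q ρ) := ((hbdd A).integrable le_top).mul_of_top_left (hbdd B)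
  rw [integral_conditionedPOVM hρ hQ hint (by simp [singleEstimator])]
  simp only [trace_mul_singleEstimator_inr, mul_assoc (d : ℂ)]
  rw [integral_const_mul]
  simp only [← mul_assoc (braket _ _)]
  rw [integral_braket_mul_braket_mul_braket]
  simp only [dualObservable, mul_add, add_mul, trace_add, trace_smul, mul_smul_comm,
    smul_mul_assoc, Matrix.mul_one, Matrix.one_mul, trace_one, Fintype.card_fin, smul_eq_mul]
  have hd : (d : ℂ) ≠ 0 := Nat.cast_ne_zero.2 (NeZero.ne d)
  have hd1 : (d : ℂ) + 1 ≠ 0 := Nat.cast_add_one_ne_zero d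
  have hd2 : (d : ℂ) + 2 ≠ 0 := by exact_mod_cast (d + 1).succ_ne_zero
  field_simp
  ring

theorem integral_trace_sandwich_singleEstimator (hρ : IsDensityMatrix ρ)
    (hQ : IsStarProjection Q) (Z D : Matrix (Fin d) (Fin d) ℂ) :
    ((d : ℂ) + 2) * ∫ x, (Z * singleEstimator x * D * singleEstimator x).trace
        ∂conditionedPOVM Q ρ =
      (d + 1) * ((subState Q ρ).trace * Z.trace * D.trace + (subState Q ρ * Z).trace * D.trace +
          Z.trace * (subState Q ρ * D).trace) -
        ((subState Q ρ).trace * (Z * D).trace + (subState Q ρ * Z * D).trace +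
          (subState Q ρ * D * Z).trace) := by
  have := hρ.neZero
  have := isProbabilityMeasure_conditionedPOVM hρ hQ
  have hX := essBounded_singleEstimator (conditionedPOVM Q ρ)
  rw [integral_conditionedPOVM hρ hQ (((((EssBounded.const Z).mul hX).mul
    (EssBounded.const D)).mul hX).memLp_trace.integrable le_top) (by simp [singleEstimator])]
  simp only [trace_sandwich_singleEstimator_inr]
  set σ := subState Q ρ
  set G : Matrix (Fin d) (Fin d) ℂ :=
    (-((d : ℂ) + 1)) • (D * Z + Z * D) + (Z * D).trace • 1 with hG
  have hsplit (u : UnitVec d) : (d : ℂ) * braket σ u *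
      (((d : ℂ) + 1) ^ 2 * (braket Z u * braket D u) + braket G u) =
      (d * ((d : ℂ) + 1) ^ 2) * (braket σ u * braket Z u * braket D u) +
        d * (braket σ u * braket G u) := by ring
  have hint {f : UnitVec d → ℂ} (hf : Continuous f) : Integrable f (haarUnit d) :=
    hf.integrable_of_hasCompactSupport (HasCompactSupport.of_compactSpace f)
  have hcont := continuous_braket (d := d)
  simp only [hsplit]
  rw [integral_add (hint (by fun_prop)) (hint (by fun_prop)), integral_const_mul,
    integral_const_mul, integral_braket_mul_braket_mul_braket, integral_braket_mul_braket, hG]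
  simp only [mul_add, trace_add, trace_smul, mul_smul_comm, Matrix.mul_one,
    trace_one, Fintype.card_fin, smul_eq_mul, trace_mul_comm D Z, ← Matrix.mul_assoc]
  have hd : (d : ℂ) ≠ 0 := Nat.cast_ne_zero.2 (NeZero.ne d)
  have hd1 : (d : ℂ) + 1 ≠ 0 := Nat.cast_add_one_ne_zero d
  have hd2 : (d : ℂ) + 2 ≠ 0 := by exact_mod_cast (d + 1).succ_ne_zero
  field_simp
  ring

theorem cross_terms_nonneg {σ : Matrix (Fin d) (Fin d) ℂ} (hσ : σ.PosSemidef)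
    (B : Matrix (Fin d) (Fin d) ℂ) :
    0 ≤ σ.trace * Bᴴ.trace * B.trace + (σ * Bᴴ).trace * B.trace + Bᴴ.trace * (σ * B).trace +
      (σ * B * Bᴴ).trace := by
  refine (hσ.conjTranspose_mul_mul_same (B + B.trace • 1)).trace_nonneg.trans_eq ?_
  have hcomm : (Bᴴ * σ).trace = (σ * Bᴴ).trace := trace_mul_comm _ _
  have hcycle : (Bᴴ * σ * B).trace = (σ * B * Bᴴ).trace := by
    rw [Matrix.mul_assoc, trace_mul_comm]
  simp only [conjTranspose_add, conjTranspose_smul, conjTranspose_one, Matrix.add_mul,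
    Matrix.mul_add, smul_mul_assoc, mul_smul_comm, Matrix.one_mul, Matrix.mul_one, trace_add,
    trace_smul, smul_eq_mul, trace_conjTranspose, hcomm, hcycle]
  ring

theorem re_le_of_natCast_add_two_mul_le {z : ℂ} {r : ℝ}
    (h : ((d : ℂ) + 2) * z ≤ ((d : ℂ) + 2) * r) : z.re ≤ r := by
  have hre := (Complex.le_def.1 h).1
  have hcast : (d : ℂ) + 2 = ((d + 2 : ℝ) : ℂ) := by push_cast; rfl
  rw [hcast, Complex.re_ofReal_mul, Complex.re_ofReal_mul, Complex.ofReal_re] at hre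
  exact le_of_mul_le_mul_left hre (by positivity)

theorem integral_norm_sq_trace_singleEstimator_le (hρ : IsDensityMatrix ρ)
    (hQ : IsStarProjection Q) (B : Matrix (Fin d) (Fin d) ℂ) :
    ∫ x, ‖(singleEstimator x * B).trace‖ ^ 2 ∂conditionedPOVM Q ρ ≤ 3 * ‖B‖ ^ 2 := by
  have hcross := cross_terms_nonneg (posSemidef_subState hρ hQ) B
  have hσ_one := trace_subState_le_one hρ hQ
  rw [← Complex.ofReal_re (∫ x, _ ∂_), ← integral_complex_ofReal]
  simp only [norm_sq_trace_singleEstimator_mul]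
  refine re_le_of_natCast_add_two_mul_le (d := d) ?_
  rw [integral_trace_mul_trace_singleEstimator hρ hQ]
  set σ := subState Q ρ
  have hF : (Bᴴ * B).trace = ((‖B‖ ^ 2 : ℝ) : ℂ) := trace_conjTranspose_mul_self B
  have hF_nonneg : 0 ≤ (Bᴴ * B).trace := (posSemidef_conjTranspose_mul_self B).trace_nonneg
  have hleft : (σ * Bᴴ * B).trace ≤ (Bᴴ * B).trace := by
    rw [Matrix.mul_assoc]
    exact trace_subState_mul_le hρ hQ (posSemidef_conjTranspose_mul_self B)
  have hright : (σ * B * Bᴴ).trace ≤ (Bᴴ * B).trace := by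
    rw [Matrix.mul_assoc, trace_mul_comm Bᴴ]
    exact trace_subState_mul_le hρ hQ (posSemidef_self_mul_conjTranspose B)
  rw [Complex.ofReal_mul, ← hF, Complex.ofReal_ofNat]
  set F := (Bᴴ * B).trace
  set T := σ.trace * Bᴴ.trace * B.trace + (σ * Bᴴ).trace * B.trace + Bᴴ.trace * (σ * B).trace
  calc ((d : ℂ) + 1) * (σ.trace * F + (σ * Bᴴ * B).trace + (σ * B * Bᴴ).trace) - T
      ≤ (d + 1) * (1 * F + F + F) - T + (T + (σ * B * Bᴴ).trace) := by
        refine le_add_of_le_of_nonneg ?_ hcross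
        gcongr
    _ = 3 * (d + 1) * F + (σ * B * Bᴴ).trace := by ring
    _ ≤ 3 * (d + 1) * F + 3 * F := by
        gcongr
        exact hright.trans (le_mul_of_one_le_left hF_nonneg (by norm_num))
    _ = (d + 2) * (3 * F) := by ring

theorem integral_trace_pow_sandwich_le (hρ : IsDensityMatrix ρ) (hQ : IsStarProjection Q) (m : ℕ)
    {D : Matrix (Fin d) (Fin d) ℂ} (hD : D.PosSemidef) :
    ((d : ℂ) + 2) * ∫ x, (subState Q ρ ^ m * singleEstimator x * D * singleEstimator x).trace
        ∂conditionedPOVM Q ρ ≤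
      (d + 2) * (3 * (subState Q ρ ^ m).trace * D.trace) := by
  have hσ := posSemidef_subState hρ hQ
  have hσ_one := trace_subState_le_one hρ hQ
  have hZ := hσ.pow m
  have hσZ : (subState Q ρ * subState Q ρ ^ m).PosSemidef := by
    rw [← pow_succ']
    exact hσ.pow (m + 1)
  have hcomm : (subState Q ρ * D * subState Q ρ ^ m).trace =
      (subState Q ρ * subState Q ρ ^ m * D).trace := by
    rw [trace_mul_comm, ← Matrix.mul_assoc, ← pow_succ, ← pow_succ']
  rw [integral_trace_sandwich_singleEstimator hρ hQ, hcomm]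
  set σ := subState Q ρ
  set Z := σ ^ m
  have hZ_nonneg := hZ.trace_nonneg
  have hD_nonneg := hD.trace_nonneg
  have hsub : 0 ≤ σ.trace * (Z * D).trace + (σ * Z * D).trace + (σ * Z * D).trace :=
    add_nonneg (add_nonneg (mul_nonneg hσ.trace_nonneg (trace_mul_nonneg hZ hD))
      (trace_mul_nonneg hσZ hD)) (trace_mul_nonneg hσZ hD)
  calc _ ≤ ((d : ℂ) + 1) * (σ.trace * Z.trace * D.trace + (σ * Z).trace * D.trace +
          Z.trace * (σ * D).trace) := sub_le_self _ hsub
    _ ≤ (d + 1) * (1 * Z.trace * D.trace + Z.trace * D.trace + Z.trace * D.trace) := by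
        gcongr
        · exact trace_subState_mul_le hρ hQ hZ
        · exact trace_subState_mul_le hρ hQ hD
    _ = (d + 1) * (3 * Z.trace * D.trace) := by ring
    _ ≤ (d + 2) * (3 * Z.trace * D.trace) := by
        gcongr
        exact one_le_two

theorem integral_norm_sq_pow_mul_singleEstimator_le (hρ : IsDensityMatrix ρ)
    (hQ : IsStarProjection Q) (a : ℕ) (B : Matrix (Fin d) (Fin d) ℂ) :
    ∫ x, ‖subState Q ρ ^ a * singleEstimator x * B‖ ^ 2 ∂conditionedPOVM Q ρ ≤
      3 * (subState Q ρ ^ (2 * a)).trace.re * ‖B‖ ^ 2 := by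
  have hσ := posSemidef_subState hρ hQ
  have htrace_pow : ((subState Q ρ ^ (2 * a)).trace.re : ℂ) = (subState Q ρ ^ (2 * a)).trace :=
    Complex.ext rfl (Complex.nonneg_iff.1 (hσ.pow _).trace_nonneg).2
  have hnorm_sq : (B * Bᴴ).trace = ((‖B‖ ^ 2 : ℝ) : ℂ) := by
    rw [trace_mul_comm, trace_conjTranspose_mul_self]
  rw [← Complex.ofReal_re (∫ x, _ ∂_), ← integral_complex_ofReal]
  simp only [norm_sq_pow_mul_singleEstimator_mul hσ.1]
  refine re_le_of_natCast_add_two_mul_le (d := d) ?_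
  rw [Complex.ofReal_mul, Complex.ofReal_mul, htrace_pow, ← hnorm_sq, Complex.ofReal_ofNat]
  exact integral_trace_pow_sandwich_le hρ hQ (2 * a) (posSemidef_self_mul_conjTranspose B)

theorem isEstimator_singleEstimator (hρ : IsDensityMatrix ρ) (hQ : IsStarProjection Q) :
    IsEstimator (conditionedPOVM Q ρ) 3 singleEstimator (subState Q ρ) where
  essBounded :=
    have := hρ.neZero
    have := isProbabilityMeasure_conditionedPOVM hρ hQ
    essBounded_singleEstimator _
  mean p q := by
    simpa [trace_single_mul] using
      integral_trace_mul_singleEstimator hρ hQ (single q p 1)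
  trace_sq_le := integral_norm_sq_trace_singleEstimator_le hρ hQ
  norm_sq_le := integral_norm_sq_pow_mul_singleEstimator_le hρ hQ

end SingleCopy

end CondMoment

theorem proposition5p7_general {d : ℕ} (ρ Q : Matrix (Fin d) (Fin d) ℂ)
    (hρ : CondMoment.IsDensityMatrix ρ) (hQ : IsStarProjection Q)
    (n k : ℕ) (hkn : k ≤ n) :
    (∀ x : Fin n → CondMoment.Outcome d, (CondMoment.momentEstimator k x).im = 0) ∧
    MemLp (fun x => CondMoment.momentEstimator k x) 2 (CondMoment.outcomeLaw n Q ρ) ∧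
    ∫ x, CondMoment.momentEstimator k x ∂(CondMoment.outcomeLaw n Q ρ) =
      (CondMoment.subState Q ρ ^ k).trace ∧
    ProbabilityTheory.variance (fun x => (CondMoment.momentEstimator k x).re)
        (CondMoment.outcomeLaw n Q ρ) ≤
      (6 : ℝ) ^ k / (d : ℝ) *
        ∑ j ∈ Finset.range k,
          ((k : ℝ) * (d : ℝ) / (n : ℝ)) ^ (k - j) *
            (CondMoment.subState Q ρ ^ (2 * j)).trace.re := by
  have := hρ.neZero
  have := CondMoment.isProbabilityMeasure_conditionedPOVM hρ hQ
  have hest := CondMoment.isEstimator_singleEstimator hρ hQ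
  have hherm := CondMoment.isHermitian_singleEstimator (d := d)
  have hσ := CondMoment.posSemidef_subState hρ hQ
  have hcard : k ≤ Fintype.card (Fin n) := hkn.trans_eq (Fintype.card_fin n).symm
  have hstat (x : Fin n → CondMoment.Outcome d) : CondMoment.momentEstimator k x =
      CondMoment.uStatistic CondMoment.singleEstimator k x := by
    rw [CondMoment.momentEstimator, CondMoment.uStatistic, Fintype.card_fin]
  simp only [hstat, CondMoment.outcomeLaw]
  refine ⟨CondMoment.im_uStatistic hherm k,
    (CondMoment.memLp_uStatistic hest.essBounded k).mono_exponent le_top,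
    CondMoment.integral_uStatistic hest hherm hσ hcard,
    (CondMoment.variance_re_uStatistic_le hest hσ (by norm_num) hcard).trans_eq ?_⟩
  norm_num

theorem proposition5p7 {d : ℕ} (ρ Q : Matrix (Fin d) (Fin d) ℂ)
    (hρ : CondMoment.IsDensityMatrix ρ) (hQ : IsStarProjection Q)
    (n k : ℕ) (hk : 1 ≤ k) (hkn : (k : ℝ) ≤ (n : ℝ) / 2) :
    (∀ x : Fin n → CondMoment.Outcome d, (CondMoment.momentEstimator k x).im = 0) ∧
    MemLp (fun x => CondMoment.momentEstimator k x) 2 (CondMoment.outcomeLaw n Q ρ) ∧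
    ∫ x, CondMoment.momentEstimator k x ∂(CondMoment.outcomeLaw n Q ρ) =
      (CondMoment.subState Q ρ ^ k).trace ∧
    ProbabilityTheory.variance (fun x => (CondMoment.momentEstimator k x).re)
        (CondMoment.outcomeLaw n Q ρ) ≤
      (24 : ℝ) ^ k / (d : ℝ) *
        ∑ j ∈ Finset.range k,
          ((k : ℝ) * (d : ℝ) / (n : ℝ)) ^ (k - j) *
            (CondMoment.subState Q ρ ^ (2 * j)).trace.re := by
  obtain ⟨him, hmem, hmean, hvar⟩ := proposition5p7_general ρ Q hρ hQ n k
    (Nat.cast_le.1 (hkn.trans (half_le_self n.cast_nonneg)))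
  have hsum := CondMoment.sum_pow_mul_re_trace_pow_nonneg (CondMoment.posSemidef_subState hρ hQ)
    (t := (k : ℝ) * d / n) (by positivity) k
  exact ⟨him, hmem, hmean, hvar.trans (by gcongr; norm_num)⟩
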